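/- **Setting.** Let $f,g:\mathbb{R}^p\times\mathbb{R}^q\to\mathbb{R}$ ($p,q\ge 1$) be continuously differentiable, with $\nabla_y g$ differentiable. Suppose that $\nabla_x f(\cdot,y)$, $\nabla_x f(x,\cdot)$, $\nabla_y f(\cdot,y)$, $\nabla_y f(x,\cdot)$ are Lipschitz with constants $L_x,L_{xy},L_{xy},L_y$; that $\nabla_y g(\cdot,y)$, $\nabla_y g(x,\cdot)$ are Lipschitz with constants $\widetilde L_{xy},\widetilde L_y$; that $\nabla_x\nabla_y g$, $\nabla_y^2 g$ are $\rho_{xy}$-, $\rho_{yy}$-Lipschitz in $(x,y)$; and that $g(x,\cdot)$ is $\mu_y$-strongly convex for every $x$ with $0<\mu_y\le\bar\mu$. Put $y^*(x)=\arg\min_y g(x,y)$ and $\Phi(x)=f(x,y^*(x))$. Suppose that $\Phi$ is convex and has a minimizer $x^*$ with $\|x^*\|=B>0$. Let $\epsilon>0$ and $$\Delta^*_{\rm CSC}=\|\nabla_y f(x^*,y^*(x^*))\|+\frac{\|x^*\|}{\mu_y}+\frac{(\|x^*\|+1)\sqrt{\Phi(0)-\Phi(x^*)}}{\sqrt{\epsilon}\,\mu_y}.$$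 **Algorithm.** AccBiO$(f,g;L_\Phi,\mu_x;M,N)$ starts from $x_0=z_0=0$. In iteration $k=0,1,\dots$, with $\kappa_y=\widetilde L_y/\mu_y$ and $\kappa_x=L_\Phi/\mu_x$: 1. it runs $N$ accelerated gradient steps from $y_k^0=s_k^0=0$, namely $y_k^t=s_k^{t-1}-\frac1{\widetilde L_y}\nabla_y g(x_k,s_k^{t-1})$, $s_k^t=\frac{2\sqrt{\kappa_y}}{\sqrt{\kappa_y}+1}y_k^t-\frac{\sqrt{\kappa_y}-1}{\sqrt{\kappa_y}+1}y_k^{t-1}$; 2. it computes $v_k^M$ by the heavy-ball method $v_k^{t+1}=v_k^t-\lambda\nabla Q(v_k^t)+\theta(v_k^t-v_k^{t-1})$, $v_k^0=v_k^1=0$, for $Q(v)=\frac12v^T\nabla_y^2g(x_k,y_k^N)v-v^T\nabla_y f(x_k,y_k^N)$, with $\lambda=\frac{4}{(\sqrt{\widetilde L_y}+\sqrt{\mu_y})^2}$ and $\theta=\max\{(1-\sqrt{\lambda\mu_y})^2,(1-\sqrt{\lambda\widetilde L_y})^2\}$; 3. with $G_k=\nabla_x f(x_k,y_k^N)-\nabla_x\nabla_y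 g(x_k,y_k^N)v_k^M$ it sets $z_{k+1}=x_k-\frac1{L_\Phi}G_k$ and $x_{k+1}=\big(1+\frac{\sqrt{\kappa_x}-1}{\sqrt{\kappa_x}+1}\big)z_{k+1}-\frac{\sqrt{\kappa_x}-1}{\sqrt{\kappa_x}+1}z_k$. Its complexity is $\tau(n_J+n_H)+n_G$, where $n_J,n_H,n_G$ count the Jacobian-vector products, Hessian-vector products and gradient evaluations made to compute $z_K$, and $\tau>0$ is a fixed constant. **Parameters.** For $R>0$ let $\widetilde f(x,y)=f(x,y)+\frac{\epsilon}{2R}\|x\|^2$, $\widetilde\Phi(x)=\widetilde f(x,y^*(x))$, $\widetilde x^*=\arg\min\widetilde\Phi$, $\mu_x=\epsilon/R$, and for an accuracy $\epsilon'$ put $$L_{\widetilde\Phi}(\epsilon')=L_x+\tfrac{\epsilon}{R}+\tfrac{2L_{xy}\widetilde L_{xy}}{\mu_y}+\tfrac{L_y\widetilde L_{xy}^2}{\mu_y^2}+\Gamma\,\|\nabla_y\widetilde f(\widetilde x^*,y^*(\widetilde x^*))\|+3\Gamma\Big(L_{xy}+\tfrac{L_y\widetilde L_{xy}}{\mu_y}\Big)\sqrt{\tfrac{2}{\mu_x}(\widetilde\Phi(0)-\widetilde\Phi(\widetilde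 x^*))+\|\widetilde x^*\|^2+\tfrac{\epsilon'}{\mu_x}},$$ with $\Gamma=\big(\tfrac{\widetilde L_{xy}\rho_{yy}}{\mu_y^2}+\tfrac{\rho_{xy}}{\mu_y}\big)\big(1+\tfrac{\widetilde L_{xy}}{\mu_y}\big)$. Let $$\ell=\log\Big(2+\epsilon+\tfrac1\epsilon+\tfrac1B+\tfrac1{\mu_y}+\widetilde L_y+\rho_{xy}+\rho_{yy}+\Delta^*_{\rm CSC}+\|y^*(x^*)\|\Big).$$ **Theorem (AccBiO, convex–strongly-convex).** There is a constant $C>0$ depending only on $L_x,L_{xy},L_y,\widetilde L_{xy},\tau$ and the upper bound $\bar\mu$ on $\mu_y$ such that, for all problems as above (in all dimensions) and all $\epsilon>0$: * *(Suboptimality gap)* Let $R=B^2$ and run AccBiO on $(\widetilde f,g)$ with $\mu_x=\epsilon/B^2$ and $L_\Phi=L_{\widetilde\Phi}(\epsilon/2)$. There are $K,M,N$ for which the complexity is at most $$C\,B\Big(\sqrt{\tfrac{\widetilde L_y}{\epsilon\mu_y^3}}+\Big(\sqrt{\tfrac{\rho_{yy}\widetilde L_y}{\epsilon\mu_y^4}}+\sqrt{\tfrac{\rho_{xy}\widetilde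 L_y}{\epsilon\mu_y^3}}\Big)\sqrt{\Delta^*_{\rm CSC}}\Big)\,\ell^2$$ and $\Phi(z_K)-\Phi(x^*)\le\epsilon$; the latter also holds for all larger $K,M,N$. * *(Gradient norm)* Let $R=B$. The equation $L=L_{\widetilde\Phi}\big(\epsilon^2/(4L+\frac{8\epsilon}{B})\big)$ has exactly one real solution $L$. Run AccBiO on $(\widetilde f,g)$ with $\mu_x=\epsilon/B$ and $L_\Phi=L$. There are $K,M,N$ for which the complexity is at most $$C\Big(\sqrt{\tfrac{B\widetilde L_y}{\epsilon\mu_y^3}}+\Big(\sqrt{\tfrac{B\rho_{yy}\widetilde L_y}{\epsilon\mu_y^4}}+\sqrt{\tfrac{B\rho_{xy}\widetilde L_y}{\epsilon\mu_y^3}}\Big)\sqrt{\Delta^*_{\rm CSC}}\Big)\,\ell^2$$ and $\Phi$ is differentiable at $z_K$ with $\|\nabla\Phi(z_K)\|\le5\epsilon$; the latter also holds for all larger $K,M,N$. -/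

import Mathlib

open Set

noncomputable section

/-- The Euclidean space `ℝⁿ`. -/
abbrev Euc (n : ℕ) : Type := EuclideanSpace ℝ (Fin n)

/-- A (chosen) minimizer of a real-valued function; an arbitrary point if there is none. -/
def argminPt {α : Type*} [Nonempty α] (h : α → ℝ) : α :=
  Classical.epsilon (fun a => ∀ b, h a ≤ h b)

section Derivatives

variable {p q : ℕ}

/-- The partial gradient `∇ₓ f (x, y)`. -/
def gradX (f : Euc p → Euc q → ℝ) (x : Euc p) (y : Euc q) : Euc p :=
  gradient (fun x' => f x' y) x

/-- The partial gradient `∇_y f (x, y)`. -/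
def gradY (f : Euc p → Euc q → ℝ) (x : Euc p) (y : Euc q) : Euc q :=
  gradient (fun y' => f x y') y

/-- The Hessian `∇²_y g (x, y)` as a linear operator on `ℝ^q`. -/
def hessYY (g : Euc p → Euc q → ℝ) (x : Euc p) (y : Euc q) : Euc q →L[ℝ] Euc q :=
  fderiv ℝ (fun y' => gradY g x y') y

/-- The `p × q` matrix `∇ₓ∇_y g (x, y) = (∂²g / ∂xᵢ∂yⱼ)` as a linear operator `ℝ^q → ℝ^p`:
the transpose of the derivative of `x ↦ ∇_y g (x, y)`. -/
def jacXY (g : Euc p → Euc q → ℝ) (x : Euc p) (y : Euc q) : Euc q →L[ℝ] Euc p :=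
  ContinuousLinearMap.adjoint (fderiv ℝ (fun x' => gradY g x' y) x)

/-- The inner-level solution `y*(x) = argmin_y g (x, y)`. -/
def innerSol (g : Euc p → Euc q → ℝ) (x : Euc p) : Euc q :=
  argminPt (g x)

/-- The total objective `Φ(x) = f (x, y*(x))`. -/
def totalObj (f g : Euc p → Euc q → ℝ) (x : Euc p) : ℝ :=
  f x (innerSol g x)

/-- The regularized outer-level function `f (x, y) + ε / (2R) ‖x‖²`. -/
def regularize (f : Euc p → Euc q → ℝ) (ε R : ℝ) (x : Euc p) (y : Euc q) : ℝ :=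
  f x y + ε / (2 * R) * ‖x‖ ^ 2

/-- The convex–strongly-convex bilevel class with smoothness parameters `Lx, Lxy, Ly` of `f`,
`Ltxy, Lty` of `g`, Lipschitz parameters `ρxy, ρyy` of the second-order derivatives of `g`, and
inner-level strong convexity parameter `μy`. The distance between `z₁ = (x₁, y₁)` and
`z₂ = (x₂, y₂)` is the Euclidean one. -/
structure IsConvexStronglyConvex (f g : Euc p → Euc q → ℝ)
    (Lx Lxy Ly Ltxy Lty ρxy ρyy μy : ℝ) : Prop where
  contDiff_f : ContDiff ℝ 1 (fun z : Euc p × Euc q => f z.1 z.2)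
  contDiff_g : ContDiff ℝ 1 (fun z : Euc p × Euc q => g z.1 z.2)
  differentiable_gradY_g : Differentiable ℝ (fun z : Euc p × Euc q => gradY g z.1 z.2)
  gradX_f_x : ∀ x₁ x₂ y, ‖gradX f x₁ y - gradX f x₂ y‖ ≤ Lx * ‖x₁ - x₂‖
  gradX_f_y : ∀ x y₁ y₂, ‖gradX f x y₁ - gradX f x y₂‖ ≤ Lxy * ‖y₁ - y₂‖
  gradY_f_x : ∀ x₁ x₂ y, ‖gradY f x₁ y - gradY f x₂ y‖ ≤ Lxy * ‖x₁ - x₂‖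
  gradY_f_y : ∀ x y₁ y₂, ‖gradY f x y₁ - gradY f x y₂‖ ≤ Ly * ‖y₁ - y₂‖
  gradY_g_x : ∀ x₁ x₂ y, ‖gradY g x₁ y - gradY g x₂ y‖ ≤ Ltxy * ‖x₁ - x₂‖
  gradY_g_y : ∀ x y₁ y₂, ‖gradY g x y₁ - gradY g x y₂‖ ≤ Lty * ‖y₁ - y₂‖
  jacXY_g : ∀ x₁ x₂ y₁ y₂, ‖jacXY g x₁ y₁ - jacXY g x₂ y₂‖ ≤
    ρxy * Real.sqrt (‖x₁ - x₂‖ ^ 2 + ‖y₁ - y₂‖ ^ 2)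
  hessYY_g : ∀ x₁ x₂ y₁ y₂, ‖hessYY g x₁ y₁ - hessYY g x₂ y₂‖ ≤
    ρyy * Real.sqrt (‖x₁ - x₂‖ ^ 2 + ‖y₁ - y₂‖ ^ 2)
  strongConvex_g : ∀ x, StrongConvexOn univ μy (g x)
  convex_totalObj : ConvexOn ℝ univ (totalObj f g)

end Derivatives

section Algorithm

variable {p q : ℕ}

/-- Numbers of gradient evaluations, Jacobian-vector and Hessian-vector products. -/
structure OracleCount where
  nG : ℕ
  nJ : ℕ
  nH : ℕ

/-- The complexity `τ (n_J + n_H) + n_G`. -/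
def OracleCount.cost (τ : ℝ) (c : OracleCount) : ℝ :=
  τ * ((c.nJ : ℝ) + (c.nH : ℝ)) + (c.nG : ℝ)

/-- State of the inner accelerated gradient descent: `y^t`, `s^t`, gradient evaluations so far. -/
structure AGDState (q : ℕ) where
  y : Euc q
  s : Euc q
  nG : ℕ

/-- Accelerated gradient descent on `g (x, ·)` from `y^0 = s^0 = 0`, with `κ_y = Lty / μy`. -/
def agd (g : Euc p → Euc q → ℝ) (Lty μy : ℝ) (x : Euc p) : ℕ → AGDState q
  | 0 => ⟨0, 0, 0⟩
  | t + 1 =>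
    let st := agd g Lty μy x t
    let r := Real.sqrt (Lty / μy)
    let y' := st.s - (1 / Lty) • gradY g x st.s
    ⟨y', (2 * r / (r + 1)) • y' - ((r - 1) / (r + 1)) • st.y, st.nG + 1⟩

/-- State of the heavy-ball method: `v^t`, `v^{t-1}`, Hessian-vector products so far. -/
structure HBState (q : ℕ) where
  v : Euc q
  vPrev : Euc q
  nH : ℕ

/-- Heavy-ball method with step sizes `lam, θ` on `Q(v) = ½ vᵀHv - vᵀb`, `∇Q(v) = Hv - b`, started
from `v^0 = v^1 = 0`. -/
def heavyBall (H : Euc q →L[ℝ] Euc q) (b : Euc q) (lam θ : ℝ) : ℕ → HBState q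
  | 0 => ⟨0, 0, 0⟩
  | 1 => ⟨0, 0, 0⟩
  | t + 2 =>
    let st := heavyBall H b lam θ (t + 1)
    ⟨st.v - lam • (H st.v - b) + θ • (st.v - st.vPrev), st.v, st.nH + 1⟩

/-- `λ = 4 / (√Lty + √μy)²`. -/
def hbLam (Lty μy : ℝ) : ℝ :=
  4 / (Real.sqrt Lty + Real.sqrt μy) ^ 2

/-- `θ = max {(1 - √(λ μy))², (1 - √(λ Lty))²}`. -/
def hbTheta (Lty μy : ℝ) : ℝ :=
  max ((1 - Real.sqrt (hbLam Lty μy * μy)) ^ 2) ((1 - Real.sqrt (hbLam Lty μy * Lty)) ^ 2)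

/-- State of AccBiO: `x_k`, `z_k`, and the oracle calls made to compute them. -/
structure AccBiOState (p : ℕ) where
  x : Euc p
  z : Euc p
  count : OracleCount

/-- AccBiO with outer-level function `f`, inner-level function `g`, `N` inner accelerated gradient
steps and `M` heavy-ball steps per outer iteration, outer step size `1 / LΦ`, `κ_x = LΦ / μx` and
`κ_y = Lty / μy`. Each outer iteration evaluates `∇_y g` in the inner loop, and `∇ₓ f`, `∇_y f` and
one Jacobian-vector product once each. -/
def accBiO (f g : Euc p → Euc q → ℝ) (Lty μy LΦ μx : ℝ) (M N : ℕ) : ℕ → AccBiOState p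
  | 0 => ⟨0, 0, ⟨0, 0, 0⟩⟩
  | k + 1 =>
    let st := accBiO f g Lty μy LΦ μx M N k
    let inner := agd g Lty μy st.x N
    let lin := heavyBall (hessYY g st.x inner.y) (gradY f st.x inner.y)
      (hbLam Lty μy) (hbTheta Lty μy) M
    let G := gradX f st.x inner.y - jacXY g st.x inner.y lin.v
    let r := Real.sqrt (LΦ / μx)
    let z' := st.x - (1 / LΦ) • G
    ⟨(1 + (r - 1) / (r + 1)) • z' - ((r - 1) / (r + 1)) • st.z, z',
      ⟨st.count.nG + inner.nG + 2, st.count.nJ + 1, st.count.nH + lin.nH⟩⟩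

/-- The smoothness parameter `L_Φ` used by AccBiO for the accuracy `ε` and an outer-level
function `f` with parameter `Lx`, `μx`-strongly convex total objective `Φ` and minimizer `x*`. -/
def smoothnessParam (f g : Euc p → Euc q → ℝ) (Lx Lxy Ly Ltxy ρxy ρyy μy μx ε : ℝ)
    (xs : Euc p) : ℝ :=
  Lx + 2 * Lxy * Ltxy / μy + Ly * Ltxy ^ 2 / μy ^ 2
    + (Ltxy * ρyy / μy ^ 2 + ρxy / μy) * (1 + Ltxy / μy) * ‖gradY f xs (innerSol g xs)‖
    + 3 * (Ltxy * ρyy / μy ^ 2 + ρxy / μy) * (1 + Ltxy / μy) * (Lxy + Ly * Ltxy / μy)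
      * Real.sqrt (2 / μx * (totalObj f g 0 - totalObj f g xs) + ‖xs‖ ^ 2 + ε / μx)

/-- The parameter `L_Φ̃` of the regularized problem: `Lx, f, x*, Φ` become
`Lx + ε/R, f̃, x̃*, Φ̃`, the strong convexity parameter is `μx = ε/R`, and the accuracy is `ε'`. -/
def regSmoothness (f g : Euc p → Euc q → ℝ) (Lx Lxy Ly Ltxy ρxy ρyy μy ε R ε' : ℝ) : ℝ :=
  smoothnessParam (regularize f ε R) g (Lx + ε / R) Lxy Ly Ltxy ρxy ρyy μy (ε / R) ε'
    (argminPt (totalObj (regularize f ε R) g))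

/-- `Δ*_CSC`. -/
def deltaCSC (f g : Euc p → Euc q → ℝ) (μy ε : ℝ) (xs : Euc p) : ℝ :=
  ‖gradY f xs (innerSol g xs)‖ + ‖xs‖ / μy
    + (‖xs‖ + 1) * Real.sqrt (totalObj f g 0 - totalObj f g xs) / (Real.sqrt ε * μy)

/-- The logarithmic factor hidden by `Õ`. -/
def logFactor (f g : Euc p → Euc q → ℝ) (Lty ρxy ρyy μy ε : ℝ) (xs : Euc p) : ℝ :=
  Real.log (2 + ε + 1 / ε + 1 / ‖xs‖ + 1 / μy + Lty + ρxy + ρyy + deltaCSC f g μy ε xs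
    + ‖innerSol g xs‖)

end Algorithm

end

/-! The regularized objective Φ̃ = Φ + ε/(2R)‖x‖² is ε/R-strongly convex, and its minimizer x̃* has
norm at most B. For R = B², a gap ε/2 for Φ̃ gives a gap ε for Φ. For R = B, the gap ε²/(4L + 8ε/B)
makes both ∇Φ̃ and the gradient of the regularizer O(ε). It remains to reach a prescribed gap ε' for
Φ̃ by acceleration with inexact gradients.

The hypergradient formula (`hasGradientAt_totalObj`) comes from the Lagrangian f(x, y) - ⟨v, ∇_y
g(x, y)⟩ with v frozen. It equals Φ along y = y*(x), and its y-derivative vanishes at the base point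
when v solves ∇²_y g v = ∇_y f. So Lipschitz continuity of y* is enough, and no derivative of y* is
used.

The smoothness bound available for Φ̃ is only local: seen from x, it grows with ‖∇_y f(x, y*(x))‖,
hence with ‖x - x̃*‖. The bound `norm_hyperGrad_sub_le` uses data at the base point x only, and
`accelerated_gradient_inexact` asks for smoothness only at base points within 3D of the minimizer.
Its Lyapunov function contracts by 1 - 1/√κ_x up to the oracle error. The same decrease keeps z_k
within D and x_k within 3D of the minimizer, so one induction yields both confinement and
convergence. The parameter L_Φ is the smoothness constant valid on that larger ball.

The oracle error decays like exp(-N/(2√κ_y)) and exp(-M/(2√κ_y)), by `norm_agd_sub_le` and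
`norm_heavyBall_sub_le`. All other quantities are at most fixed powers of W, a constant times the
argument of ℓ. Hence M, N of order √κ_y log W and K of order √κ_x log W suffice
(`accBiO_regularize_gap_le`), at cost of order √(κ_x κ_y) log² W.

Finally L_Φ ≤ ε/R + 9c⁴A with A = `smoothnessScale` (`regSmoothness_le`). If ε/R dominates, √κ_x is
not controlled by √(AR/ε), but then the starting point 0 already has gap at most ε'/2 and K = 0
works. Otherwise L_Φ ≤ 17·9c⁴A, and splitting √A gives the stated bounds. -/

section Convex

/-! ### Convexity, descent and existence of minimizers -/

variable {E : Type*} [NormedAddCommGroup E] [InnerProductSpace ℝ E] [CompleteSpace E]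

/-- The derivative of a function along a line. -/
lemma HasGradientAt.hasDerivAt_line {φ : E → ℝ} {g x u : E} {t : ℝ}
    (h : HasGradientAt φ g (x + t • u)) :
    HasDerivAt (fun s : ℝ => φ (x + s • u)) (inner ℝ g u) t := by
  have h1 : HasDerivAt (fun s : ℝ => x + s • u) u t := by
    simpa using ((hasDerivAt_id t).smul_const u).const_add x
  have := h.hasFDerivAt.comp_hasDerivAt t h1
  exact this.congr_deriv (by simp)

/-- The gradient inequality for convex functions. -/
lemma ConvexOn.add_inner_gradient_le {φ : E → ℝ} (hc : ConvexOn ℝ univ φ) {g x : E}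
    (h : HasGradientAt φ g x) (u : E) : φ x + inner ℝ g (u - x) ≤ φ u := by
  have hd : HasDerivAt (fun s : ℝ => φ (x + s • (u - x))) (inner ℝ g (u - x)) 0 :=
    HasGradientAt.hasDerivAt_line (by simpa using h)
  have hcv : ConvexOn ℝ univ (fun s : ℝ => φ (x + s • (u - x))) := by
    have := hc.comp_affineMap (AffineMap.lineMap x u : ℝ →ᵃ[ℝ] E)
    refine this.congr ?_ |>.subset (subset_univ _) convex_univ |> fun h => h
    intro s _
    simp [AffineMap.lineMap_apply, add_comm]
  have := hcv.le_slope_of_hasDerivAt (mem_univ 0) (mem_univ 1) zero_lt_one hd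
  simp [slope_def_field] at this
  linarith

/-- The gradient inequality for strongly convex functions. -/
lemma StrongConvexOn.add_inner_gradient_le {φ : E → ℝ} {μ : ℝ} (hc : StrongConvexOn univ μ φ)
    {g x : E} (h : HasGradientAt φ g x) (u : E) :
    φ x + inner ℝ g (u - x) + μ / 2 * ‖u - x‖ ^ 2 ≤ φ u := by
  have h1 := strongConvexOn_iff_convex.1 hc
  have h2 : HasGradientAt (fun y => φ y - μ / 2 * ‖y‖ ^ 2) (g - μ • x) x := by
    rw [hasGradientAt_iff_hasFDerivAt]
    refine (h.hasFDerivAt.sub ((hasStrictFDerivAt_norm_sq x).hasFDerivAt.const_mul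
      (μ / 2))).congr_fderiv ?_
    ext v
    simp
    ring
  have h3 := h1.add_inner_gradient_le h2 u
  have h4 : ‖u - x‖ ^ 2 = ‖u‖ ^ 2 - 2 * inner ℝ x u + ‖x‖ ^ 2 := by
    rw [norm_sub_sq_real, real_inner_comm]
  simp only [inner_sub_left, inner_sub_right, inner_smul_left, real_inner_self_eq_norm_sq] at h3 ⊢
  simp only [conj_trivial] at h3
  rw [h4]
  linarith

/-- The descent lemma, with a Lipschitz condition at one base point. -/
lemma le_add_inner_gradient_add_sq {φ : E → ℝ} {φ' : E → E}
    (hg : ∀ x, HasGradientAt φ (φ' x) x) {L : ℝ} {x : E}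
    (hL : ∀ u, ‖φ' u - φ' x‖ ≤ L * ‖u - x‖) (u : E) :
    φ u ≤ φ x + inner ℝ (φ' x) (u - x) + L / 2 * ‖u - x‖ ^ 2 := by
  -- ψ decreases on [0, 1]: its derivative contains only differences φ' (x + t v) - φ' x, so no
  -- Lipschitz bound at other base points is needed.
  set v := u - x with hv
  set ψ : ℝ → ℝ := fun t => φ (x + t • v) - t * inner ℝ (φ' x) v - L / 2 * t ^ 2 * ‖v‖ ^ 2 with hψ
  have hd : ∀ t, HasDerivAt ψ
      (inner ℝ (φ' (x + t • v)) v - inner ℝ (φ' x) v - L * t * ‖v‖ ^ 2) t := by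
    intro t
    have h1 : HasDerivAt (fun s : ℝ => φ (x + s • v)) (inner ℝ (φ' (x + t • v)) v) t :=
      HasGradientAt.hasDerivAt_line (hg _)
    have h2 := (hasDerivAt_id t).mul_const (inner ℝ (φ' x) v : ℝ)
    have h3 := (((hasDerivAt_pow 2 t).const_mul (L / 2)).mul_const (‖v‖ ^ 2))
    refine ((h1.sub h2).sub h3).congr_deriv ?_
    push_cast
    ring
  have hanti : AntitoneOn ψ (Icc 0 1) := by
    refine antitoneOn_of_deriv_nonpos (convex_Icc 0 1)
      (fun t _ => (hd t).continuousAt.continuousWithinAt)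
      (fun t _ => (hd t).differentiableAt.differentiableWithinAt) ?_
    intro t ht
    rw [interior_Icc] at ht
    rw [(hd t).deriv, ← inner_sub_left]
    have h1 := real_inner_le_norm (φ' (x + t • v) - φ' x) v
    have h2 := hL (x + t • v)
    rw [add_sub_cancel_left, norm_smul, Real.norm_of_nonneg ht.1.le] at h2
    have h3 := mul_le_mul_of_nonneg_right h2 (norm_nonneg v)
    nlinarith
  have := hanti (left_mem_Icc.2 zero_le_one) (right_mem_Icc.2 zero_le_one) zero_le_one
  simp [hψ, hv] at this
  linarith

lemma argminPt_le {α : Type*} [Nonempty α] {h : α → ℝ} (hex : ∃ a, ∀ b, h a ≤ h b) (b : α) :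
    h (argminPt h) ≤ h b :=
  Classical.epsilon_spec (p := fun a => ∀ b, h a ≤ h b) hex b

lemma HasGradientAt.eq_zero_of_forall_le {φ : E → ℝ} {g a : E} (h : HasGradientAt φ g a)
    (hm : ∀ b, φ a ≤ φ b) : g = 0 := by
  have h1 : IsLocalMin φ a := Filter.Eventually.of_forall hm
  have h2 := h1.hasFDerivAt_eq_zero h.hasFDerivAt
  simpa using h2

end Convex

/-- A continuous function on a finite-dimensional space with a quadratic lower bound has a
minimizer. -/
lemma exists_forall_le_of_quadratic_lower_bound {E : Type*}
    [NormedAddCommGroup E] [InnerProductSpace ℝ E] [FiniteDimensional ℝ E] {φ : E → ℝ}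
    (hc : Continuous φ) {μ : ℝ} (hμ : 0 < μ) {g : E}
    (h : ∀ u, φ 0 + inner ℝ g u + μ / 2 * ‖u‖ ^ 2 ≤ φ u) : ∃ a, ∀ b, φ a ≤ φ b := by
  have : ProperSpace E := FiniteDimensional.proper ℝ E
  -- Outside this radius the quadratic term beats the linear one, so φ exceeds φ 0 there.
  obtain ⟨a, ha, hm⟩ := (isCompact_closedBall (0 : E) (2 * ‖g‖ / μ)).exists_isMinOn
    ⟨0, by simp; positivity⟩ hc.continuousOn
  refine ⟨a, fun b => ?_⟩
  by_cases hb : b ∈ Metric.closedBall (0 : E) (2 * ‖g‖ / μ)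
  · exact hm hb
  · have h0 : φ a ≤ φ 0 := hm (by simp; positivity)
    have h1 := h b
    have h2 := abs_real_inner_le_norm g b
    rw [mem_closedBall_zero_iff, not_le, div_lt_iff₀ hμ] at hb
    have h3 := neg_le_of_abs_le h2
    have h4 : 0 ≤ ‖b‖ := norm_nonneg b
    nlinarith

/-! ### Accelerated gradient descent with inexact gradients and local smoothness -/

section AcceleratedGradient

variable {E : Type*} [NormedAddCommGroup E] [InnerProductSpace ℝ E]

/-- Here X = x_k - x*, Z = z_k - x*, and the step size is 1/(μ r²). The first square is the next
Lyapunov vector. The vector paired with G is the one produced by averaging the strong convexity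
inequalities towards z_k and x* with weights 1 - 1/r and 1/r, so the inner products cancel in the
energy estimate. -/
lemma accelerated_step_identity (X Z G : E) {r μ : ℝ} (hr : 0 < r) (hμ : 0 < μ) :
    μ / 2 * ‖r • (X - (1 / (μ * r ^ 2)) • G) - (r - 1) • Z‖ ^ 2 + μ / 2 * (r - 1) * ‖X - Z‖ ^ 2
      = (1 - 1 / r) * (μ / 2 * ‖X + r • (X - Z)‖ ^ 2) + 1 / r * (μ / 2 * ‖X‖ ^ 2)
        - inner ℝ G ((1 - 1 / r) • (X - Z) + (1 / r) • X) + ‖G‖ ^ 2 / (2 * (μ * r ^ 2)) := by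
  simp only [← real_inner_self_eq_norm_sq, inner_add_left, inner_add_right, inner_sub_left,
    inner_sub_right, inner_smul_left, inner_smul_right, conj_trivial]
  rw [real_inner_comm X Z, real_inner_comm X G, real_inner_comm Z G]
  field_simp
  ring

/-- Accelerated gradient descent for a strongly convex function with an inexact gradient oracle.
The gradient is Lipschitz with constant `μ r²` at base points near the minimizer only. -/
theorem accelerated_gradient_inexact [CompleteSpace E] {φ : E → ℝ} {φ' G : E → E} {xs : E}
    {r μ D δ η : ℝ}
    (hr : 1 ≤ r) (hμ : 0 < μ) (hD : 0 ≤ D) (hδ : 0 ≤ δ) (hη : 0 ≤ η)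
    (hgrad : ∀ x, HasGradientAt φ (φ' x) x)
    (hsc : ∀ x u, φ x + inner ℝ (φ' x) (u - x) + μ / 2 * ‖u - x‖ ^ 2 ≤ φ u)
    (hsm : ∀ x, ‖x - xs‖ ≤ 3 * D → ∀ u, ‖φ' u - φ' x‖ ≤ μ * r ^ 2 * ‖u - x‖)
    (hxs : φ' xs = 0)
    (hG : ∀ x, ‖x - xs‖ ≤ 3 * D → ‖G x - φ' x‖ ≤ δ)
    (hδη : δ * (7 * D + δ / (μ * r ^ 2)) ≤ η / r)
    {x z : ℕ → E} (h0 : x 0 = z 0)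
    (hz : ∀ k, z (k + 1) = x k - (1 / (μ * r ^ 2)) • G (x k))
    (hx : ∀ k, x (k + 1) = (1 + (r - 1) / (r + 1)) • z (k + 1) - ((r - 1) / (r + 1)) • z k)
    (hDη : 2 / μ * (φ (z 0) - φ xs + μ / 2 * ‖z 0 - xs‖ ^ 2 + η) ≤ D ^ 2) (k : ℕ) :
    ‖z k - xs‖ ≤ D ∧
      φ (z k) - φ xs ≤ (1 - 1 / r) ^ k * (φ (z 0) - φ xs + μ / 2 * ‖z 0 - xs‖ ^ 2) + η := by
  have hr0 : 0 < r := by linarith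
  have hL : 0 < μ * r ^ 2 := by positivity
  set L := μ * r ^ 2 with hLdef
  set E0 := φ (z 0) - φ xs + μ / 2 * ‖z 0 - xs‖ ^ 2 with hE0
  have hlow : ∀ u, μ / 2 * ‖u - xs‖ ^ 2 ≤ φ u - φ xs := by
    intro u
    have := hsc xs u
    rw [hxs, inner_zero_left] at this
    linarith
  have hE0nn : 0 ≤ E0 := by
    have := hlow (z 0)
    have h2 : 0 ≤ μ / 2 * ‖z 0 - xs‖ ^ 2 := by positivity
    linarith
  have hα : 0 ≤ 1 - 1 / r := by
    rw [sub_nonneg, div_le_one hr0]; exact hr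
  have hα1 : 1 - 1 / r ≤ 1 := by
    have : 0 ≤ 1 / r := by positivity
    linarith
  -- By strong convexity the sublevel set at height E0 + η lies in the ball of radius D; this is how
  -- the energy bound confines the iterates.
  have hball : ∀ u, φ u - φ xs ≤ E0 + η → ‖u - xs‖ ≤ D := by
    intro u hu
    refine abs_le_of_sq_le_sq' ?_ hD |>.2
    refine le_trans ?_ hDη
    rw [div_mul_eq_mul_div, le_div_iff₀ hμ]
    have := hlow u
    linarith
  have hβ : 0 ≤ (r - 1) / (r + 1) := div_nonneg (by linarith) (by linarith)
  have hβ1 : (r - 1) / (r + 1) ≤ 1 := by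
    rw [div_le_one (by linarith)]; linarith
  have key : ∀ k, φ (z k) - φ xs + μ / 2 * ‖(x k - xs) + r • (x k - z k)‖ ^ 2
      ≤ (1 - 1 / r) ^ k * E0 + η ∧ ‖x k - xs‖ ≤ 3 * D := by
    intro k
    induction k with
    | zero =>
      constructor
      · rw [h0]; simp [hE0, hη]
      · rw [h0]
        have := hball (z 0) (by
          have h2 : 0 ≤ μ / 2 * ‖z 0 - xs‖ ^ 2 := by positivity
          linarith)
        linarith
    | succ k ih =>
      obtain ⟨ihE, ihx⟩ := ih
      have hpow : (1 - 1 / r) ^ k * E0 ≤ E0 :=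
        mul_le_of_le_one_left hE0nn (pow_le_one₀ hα hα1)
      have hzk : ‖z k - xs‖ ≤ D := hball _ (by
        have h2 : 0 ≤ μ / 2 * ‖(x k - xs) + r • (x k - z k)‖ ^ 2 := by positivity
        linarith)
      have he := hG _ ihx
      set e := G (x k) - φ' (x k) with hedef
      have hgn : ‖φ' (x k)‖ ≤ L * (3 * D) := by
        have := hsm _ ihx xs
        rw [hxs, zero_sub, norm_neg, norm_sub_rev] at this
        exact this.trans (mul_le_mul_of_nonneg_left ihx hL.le)
      -- An a priori bound, needed before z_{k+1} is known to lie within D: 3D from x_k, 3D from the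
      -- exact gradient step, δ/L from the error.
      have hzk1 : ‖z (k + 1) - xs‖ ≤ 6 * D + δ / L := by
        have h1 : z (k + 1) - xs = (x k - xs) - (1 / L) • φ' (x k) - (1 / L) • e := by
          rw [hz, hedef]; module
        rw [h1]
        refine (norm_sub_le _ _).trans ?_
        have h2 : ‖(1 / L) • e‖ ≤ δ / L := by
          rw [norm_smul, Real.norm_of_nonneg (by positivity), one_div, inv_mul_eq_div]
          gcongr
        have h3 : ‖(1 / L) • φ' (x k)‖ ≤ 3 * D := by
          rw [norm_smul, Real.norm_of_nonneg (by positivity), one_div, inv_mul_eq_div,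
            div_le_iff₀ hL]
          linarith
        have h4 := norm_sub_le (x k - xs) ((1 / L) • φ' (x k))
        linarith
      have hdesc := le_add_inner_gradient_add_sq hgrad (hsm _ ihx) (z (k + 1))
      have hA := hsc (x k) (z k)
      have hB := hsc (x k) xs
      have hid := accelerated_step_identity (x k - xs) (z k - xs) (G (x k)) hr0 hμ
      rw [← hLdef] at hid
      -- The momentum (r - 1)/(r + 1) is chosen so that, times 1 + r, it equals r - 1; the new
      -- Lyapunov vector is then the one in `accelerated_step_identity`.
      have hw : (x (k + 1) - xs) + r • (x (k + 1) - z (k + 1)) =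
          r • ((x k - xs) - (1 / L) • G (x k)) - (r - 1) • (z k - xs) := by
        have h1 : z (k + 1) - z k = (x k - z k) - (1 / L) • G (x k) := by rw [hz]; abel
        have h2 : x (k + 1) = z (k + 1) + ((r - 1) / (r + 1)) • (z (k + 1) - z k) := by
          rw [hx]; module
        have h3 : (x (k + 1) - xs) + r • (x (k + 1) - z (k + 1)) =
            (z (k + 1) - xs) + ((1 + r) * ((r - 1) / (r + 1))) • (z (k + 1) - z k) := by
          rw [h2]; module
        have h4 : (1 + r) * ((r - 1) / (r + 1)) = r - 1 := by
          rw [mul_comm, add_comm 1 r]; exact div_mul_cancel₀ _ (by linarith)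
        rw [h3, h4, h1, hz]
        module
      have hsub : (x k - xs) - (z k - xs) = x k - z k := by abel
      rw [hsub] at hid
      rw [← hw] at hid
      have hdz : z (k + 1) - x k = -((1 / L) • G (x k)) := by rw [hz]; abel
      have hφ : φ' (x k) = G (x k) - e := by rw [hedef]; abel
      -- The two terms have norm at most D and 6D + δ/L, whence the 7D in `hδη`.
      have herr : inner ℝ e ((1 - 1 / r) • (z k - xs) - (z (k + 1) - xs))
          ≤ δ * (7 * D + δ / L) := by
        refine (real_inner_le_norm _ _).trans (mul_le_mul he ?_ (norm_nonneg _) hδ)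
        refine (norm_sub_le _ _).trans ?_
        rw [norm_smul, Real.norm_of_nonneg hα]
        have := mul_le_mul hα1 hzk (norm_nonneg _) zero_le_one
        linarith
      have hstep : φ (z (k + 1)) - φ xs
          + μ / 2 * ‖(x (k + 1) - xs) + r • (x (k + 1) - z (k + 1))‖ ^ 2
          ≤ (1 - 1 / r) * (φ (z k) - φ xs + μ / 2 * ‖(x k - xs) + r • (x k - z k)‖ ^ 2)
            + inner ℝ e ((1 - 1 / r) • (z k - xs) - (z (k + 1) - xs)) := by
        have e1 : z (k + 1) - xs = (x k - xs) - (1 / L) • G (x k) := by rw [hz]; abel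
        have e2 : z k - xs = (x k - xs) - (x k - z k) := by abel
        have e3 : z k - x k = - (x k - z k) := by abel
        have e4 : xs - x k = - (x k - xs) := by abel
        rw [e1, e2]
        rw [hdz, hφ] at hdesc
        rw [e3, hφ] at hA
        rw [e4, hφ] at hB
        simp only [norm_neg, norm_smul, mul_pow, Real.norm_eq_abs, sq_abs, inner_neg_right,
          inner_sub_left, inner_sub_right, inner_add_right, inner_smul_right,
          real_inner_self_eq_norm_sq] at hdesc hA hB hid ⊢
        have hm1 : 0 ≤ μ / 2 * (r - 1) * ‖x k - z k‖ ^ 2 := by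
          have : 0 ≤ r - 1 := by linarith
          positivity
        have hm2 : 0 ≤ μ / 2 * ‖x k - z k‖ ^ 2 := by positivity
        have hA' := mul_le_mul_of_nonneg_left hA hα
        have hB' := mul_le_mul_of_nonneg_left hB (show (0 : ℝ) ≤ 1 / r by positivity)
        have hm3 := mul_nonneg hα hm2
        have hLL : L / 2 * ((1 / L) ^ 2 * ‖G (x k)‖ ^ 2) = ‖G (x k)‖ ^ 2 / (2 * L) := by
          field_simp
        have hLL2 : 1 / L * ‖G (x k)‖ ^ 2 = 2 * (‖G (x k)‖ ^ 2 / (2 * L)) := by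
          field_simp
        rw [hLL, mul_sub, hLL2] at hdesc
        linarith
      have hE : φ (z (k + 1)) - φ xs
          + μ / 2 * ‖(x (k + 1) - xs) + r • (x (k + 1) - z (k + 1))‖ ^ 2
          ≤ (1 - 1 / r) ^ (k + 1) * E0 + η := by
        -- The per-step error η/r is exactly what the contraction takes off η: (1 - 1/r)η + η/r = η.
        have h1 := mul_le_mul_of_nonneg_left ihE hα
        have h2 : (1 - 1 / r) * ((1 - 1 / r) ^ k * E0 + η)
            = (1 - 1 / r) ^ (k + 1) * E0 + η - η / r := by ring
        linarith
      refine ⟨hE, ?_⟩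
      have hpow' : (1 - 1 / r) ^ (k + 1) * E0 ≤ E0 :=
        mul_le_of_le_one_left hE0nn (pow_le_one₀ hα hα1)
      have hz1 : ‖z (k + 1) - xs‖ ≤ D := hball _ (by
        have h2 : 0 ≤ μ / 2 * ‖(x (k + 1) - xs) + r • (x (k + 1) - z (k + 1))‖ ^ 2 := by
          positivity
        linarith)
      -- Extrapolation uses coefficients at most 2 and 1, so two points within D give a point within
      -- 3D.
      have h5 : x (k + 1) - xs = (1 + (r - 1) / (r + 1)) • (z (k + 1) - xs)
          - ((r - 1) / (r + 1)) • (z k - xs) := by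
        rw [hx]; module
      rw [h5]
      refine (norm_sub_le _ _).trans ?_
      rw [norm_smul, norm_smul, Real.norm_of_nonneg hβ, Real.norm_of_nonneg (by linarith)]
      have h6 := mul_le_mul hβ1 hzk (norm_nonneg _) zero_le_one
      have h7 := mul_le_mul (show 1 + (r - 1) / (r + 1) ≤ 2 by linarith) hz1 (norm_nonneg _)
        (by norm_num)
      linarith
  have h1 := (key k).1
  have h2 : 0 ≤ μ / 2 * ‖(x k - xs) + r • (x k - z k)‖ ^ 2 := by positivity
  have hpow : (1 - 1 / r) ^ k * E0 ≤ E0 :=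
    mul_le_of_le_one_left hE0nn (pow_le_one₀ hα hα1)
  exact ⟨hball _ (by linarith), by linarith⟩

end AcceleratedGradient

/-! ### Linear convergence of the heavy-ball method -/

section HeavyBall

variable {E : Type*} [NormedAddCommGroup E] [InnerProductSpace ℝ E]

/-- A symmetric operator is bounded by its quadratic form. -/
lemma inner_map_le_of_abs_inner_map_self_le {T : E →L[ℝ] E}
    (hT : ∀ x y, inner ℝ (T x) y = inner ℝ x (T y)) {c : ℝ}
    (hc : ∀ x, |inner ℝ (T x) x| ≤ c * ‖x‖ ^ 2) (x y : E) :
    inner ℝ (T x) y ≤ c * (‖x‖ * ‖y‖) := by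
  rcases eq_or_ne x 0 with rfl | hx
  · simp
  rcases eq_or_ne y 0 with rfl | hy
  · simp
  have hx' : 0 < ‖x‖ := norm_pos_iff.2 hx
  have hy' : 0 < ‖y‖ := norm_pos_iff.2 hy
  -- Polarization, with x and y first rescaled to equal norm so that the bound is the product of the
  -- norms.
  have h1 := (abs_le.1 (hc (‖y‖ • x + ‖x‖ • y))).2
  have h2 := (abs_le.1 (hc (‖y‖ • x - ‖x‖ • y))).1
  have h3 : inner ℝ (T y) x = inner ℝ (T x) y := by rw [hT, real_inner_comm]
  rw [norm_add_sq_real] at h1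
  rw [norm_sub_sq_real] at h2
  simp only [map_add, map_sub, map_smul, inner_add_left, inner_add_right, inner_sub_left,
    inner_sub_right, inner_smul_left, inner_smul_right, conj_trivial, norm_smul, norm_norm,
    h3] at h1 h2
  have h4 : (‖x‖ * ‖y‖) * inner ℝ (T x) y ≤ (‖x‖ * ‖y‖) * (c * (‖x‖ * ‖y‖)) := by
    nlinarith
  exact le_of_mul_le_mul_left h4 (by positivity)

/-- Decay of a second-order recursion whose characteristic roots have modulus `ρ`. -/
lemma norm_le_of_second_order_recursion {T : E →L[ℝ] E}
    (hT : ∀ x y, inner ℝ (T x) y = inner ℝ x (T y)) {ρ : ℝ} (hρ : 0 ≤ ρ) (hρ1 : ρ ≤ 1)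
    (hTρ : ∀ x, |inner ℝ (T x) x| ≤ 2 * ρ * ‖x‖ ^ 2) {e : ℕ → E} (h01 : e 1 = e 0)
    (he : ∀ t, e (t + 2) = T (e (t + 1)) - ρ ^ 2 • e t) (t : ℕ) :
    ‖e (t + 1)‖ ≤ (2 * t + 3) * ρ ^ t * ‖e 0‖ := by
  have hb := inner_map_le_of_abs_inner_map_self_le hT hTρ
  -- This quadratic form is multiplied by exactly ρ² at each step, by symmetry of T, so no
  -- diagonalization is needed. Since ⟨T a, b⟩ ≤ 2ρ‖a‖‖b‖, it dominates (‖e (t + 1)‖ - ρ‖e t‖)²; the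
  -- resulting first-order recursion accounts for the factor linear in t.
  have hI : ∀ t, ‖e (t + 1)‖ ^ 2 - inner ℝ (T (e (t + 1))) (e t) + ρ ^ 2 * ‖e t‖ ^ 2
      ≤ (ρ ^ t * (2 * ‖e 0‖)) ^ 2 := by
    intro t
    induction t with
    | zero =>
      have h1 := hb (e 0) (-(e 0))
      rw [inner_neg_right, norm_neg] at h1
      simp only [zero_add, h01, pow_zero, one_mul]
      have h2 : 0 ≤ ‖e 0‖ ^ 2 := by positivity
      have h3 : ρ ^ 2 ≤ 1 := pow_le_one₀ hρ hρ1
      nlinarith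
    | succ t ih =>
      have h1 : ‖e (t + 2)‖ ^ 2 = inner ℝ (e (t + 2)) (T (e (t + 1))) - ρ ^ 2 *
          inner ℝ (e (t + 2)) (e t) := by
        nth_rw 1 [← real_inner_self_eq_norm_sq]
        nth_rw 2 [he]
        rw [inner_sub_right, inner_smul_right]
      have h2 : inner ℝ (e (t + 2)) (e t) = inner ℝ (T (e (t + 1))) (e t) - ρ ^ 2 * ‖e t‖ ^ 2 := by
        rw [he, inner_sub_left, inner_smul_left, real_inner_self_eq_norm_sq, conj_trivial]
      have h3 := mul_le_mul_of_nonneg_left ih (sq_nonneg ρ)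
      rw [show t + 1 + 1 = t + 2 from rfl, h1, hT (e (t + 2)), h2]
      have h4 : (ρ ^ (t + 1) * (2 * ‖e 0‖)) ^ 2 = ρ ^ 2 * (ρ ^ t * (2 * ‖e 0‖)) ^ 2 := by ring
      rw [h4]
      linarith
  have hstep : ∀ t, ‖e (t + 1)‖ ≤ ρ * ‖e t‖ + ρ ^ t * (2 * ‖e 0‖) := by
    intro t
    have h1 := hI t
    have h2 := hb (e (t + 1)) (e t)
    have h3 : (‖e (t + 1)‖ - ρ * ‖e t‖) ^ 2 ≤ (ρ ^ t * (2 * ‖e 0‖)) ^ 2 := by nlinarith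
    have h4 := (abs_le_of_sq_le_sq' h3 (by positivity)).2
    linarith
  induction t with
  | zero =>
    have := norm_nonneg (e 0)
    simp only [zero_add, h01, pow_zero, Nat.cast_zero]
    linarith
  | succ t ih =>
    have h1 := hstep (t + 1)
    have h2 := mul_le_mul_of_nonneg_left ih hρ
    push_cast
    have h3 : ρ * ((2 * t + 3) * ρ ^ t * ‖e 0‖) + ρ ^ (t + 1) * (2 * ‖e 0‖)
        = (2 * (t + 1) + 3) * ρ ^ (t + 1) * ‖e 0‖ := by ring
    rw [show t + 1 + 1 = t + 2 from rfl] at h1 ⊢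
    linarith

/-- With a = √L and b = √μ one has λ = (2/(a + b))², and both entries of the maximum equal ρ² for ρ
= (a - b)/(a + b). The last two identities say that 1 + θ - λh runs from 2ρ to -2ρ as h runs from μ
to L, so all characteristic roots have modulus ρ. -/
lemma hbTheta_hbLam {L μ : ℝ} (hμ : 0 < μ) (hL : μ ≤ L) :
    ∃ ρ : ℝ, 0 ≤ ρ ∧ ρ ≤ 1 - 1 / Real.sqrt (L / μ) ∧ hbTheta L μ = ρ ^ 2 ∧
      1 + ρ ^ 2 - hbLam L μ * μ = 2 * ρ ∧ 1 + ρ ^ 2 - hbLam L μ * L = -(2 * ρ) := by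
  obtain ⟨b, hb, rfl⟩ : ∃ b : ℝ, 0 < b ∧ b ^ 2 = μ := ⟨√μ, Real.sqrt_pos.2 hμ, Real.sq_sqrt hμ.le⟩
  obtain ⟨a, ha, rfl⟩ : ∃ a : ℝ, 0 < a ∧ a ^ 2 = L :=
    ⟨√L, Real.sqrt_pos.2 (hμ.trans_le hL), Real.sq_sqrt (hμ.trans_le hL).le⟩
  have hab : b ≤ a := le_of_sq_le_sq hL ha.le
  have hlam : hbLam (a ^ 2) (b ^ 2) = (2 / (a + b)) ^ 2 := by
    rw [hbLam, Real.sqrt_sq ha.le, Real.sqrt_sq hb.le, div_pow]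
    norm_num
  have h1 : √(hbLam (a ^ 2) (b ^ 2) * b ^ 2) = 2 / (a + b) * b := by
    rw [hlam, ← mul_pow, Real.sqrt_sq (by positivity)]
  have h2 : √(hbLam (a ^ 2) (b ^ 2) * a ^ 2) = 2 / (a + b) * a := by
    rw [hlam, ← mul_pow, Real.sqrt_sq (by positivity)]
  refine ⟨(a - b) / (a + b), div_nonneg (by linarith) (by linarith), ?_, ?_, ?_, ?_⟩
  · rw [← div_pow, Real.sqrt_sq (by positivity), one_div_div, one_sub_div ha.ne']
    exact div_le_div_of_nonneg_left (by linarith) ha (by linarith)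
  · rw [hbTheta, h1, h2]
    have e1 : 1 - 2 / (a + b) * b = (a - b) / (a + b) := by field_simp; ring
    have e2 : 1 - 2 / (a + b) * a = -((a - b) / (a + b)) := by field_simp; ring
    rw [e1, e2, neg_sq, max_self]
  · rw [hlam]; field_simp; ring
  · rw [hlam]; field_simp; ring

/-- Linear convergence of the heavy-ball method. -/
theorem norm_heavyBall_sub_le {q : ℕ} {H : Euc q →L[ℝ] Euc q} {L μ : ℝ} (hμ : 0 < μ) (hL : μ ≤ L)
    (hH : ∀ x y, inner ℝ (H x) y = inner ℝ x (H y))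
    (hHμ : ∀ x, μ * ‖x‖ ^ 2 ≤ inner ℝ (H x) x) (hHL : ∀ x, inner ℝ (H x) x ≤ L * ‖x‖ ^ 2)
    {b v : Euc q} (hv : H v = b) (M : ℕ) :
    ‖(heavyBall H b (hbLam L μ) (hbTheta L μ) M).v - v‖
      ≤ 18 * Real.sqrt (L / μ) * Real.exp (-(M / (2 * Real.sqrt (L / μ)))) * ‖v‖ := by
  obtain ⟨ρ, hρ, hρr, hθ, hρμ, hρL⟩ := hbTheta_hbLam hμ hL
  set lam := hbLam L μ
  set r := Real.sqrt (L / μ) with hr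
  have hr1 : 1 ≤ r := by
    rw [hr, Real.one_le_sqrt, one_le_div hμ]; exact hL
  have hr0 : 0 < r := by linarith
  have hlam : 0 ≤ lam := div_nonneg (by norm_num) (sq_nonneg _)
  rw [hθ]
  set T : Euc q →L[ℝ] Euc q := (1 + ρ ^ 2) • ContinuousLinearMap.id ℝ (Euc q) - lam • H with hTdef
  have hTa : ∀ x, T x = (1 + ρ ^ 2) • x - lam • H x := fun x => by simp [hTdef]
  have hT : ∀ x y, inner ℝ (T x) y = inner ℝ x (T y) := by
    intro x y
    rw [hTa, hTa, inner_sub_left, inner_sub_right, inner_smul_left, inner_smul_left,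
      inner_smul_right, inner_smul_right, hH]
    simp
  have hTρ : ∀ x, |inner ℝ (T x) x| ≤ 2 * ρ * ‖x‖ ^ 2 := by
    intro x
    rw [hTa, inner_sub_left, inner_smul_left, inner_smul_left, real_inner_self_eq_norm_sq,
      conj_trivial, conj_trivial, abs_le]
    have h1 := mul_le_mul_of_nonneg_left (hHμ x) hlam
    have h2 := mul_le_mul_of_nonneg_left (hHL x) hlam
    constructor
    · have : -(2 * ρ * ‖x‖ ^ 2) = (1 + ρ ^ 2 - lam * L) * ‖x‖ ^ 2 := by rw [hρL]; ring
      linarith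
    · have : 2 * ρ * ‖x‖ ^ 2 = (1 + ρ ^ 2 - lam * μ) * ‖x‖ ^ 2 := by rw [hρμ]
      linarith
  have hprev : ∀ t, (heavyBall H b lam (ρ ^ 2) (t + 1)).vPrev = (heavyBall H b lam (ρ ^ 2) t).v := by
    intro t
    cases t <;> rfl
  have hrec : ∀ t, (heavyBall H b lam (ρ ^ 2) (t + 2)).v - v
      = T ((heavyBall H b lam (ρ ^ 2) (t + 1)).v - v)
        - ρ ^ 2 • ((heavyBall H b lam (ρ ^ 2) t).v - v) := by
    intro t
    rw [heavyBall, hTa, map_sub, hv]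
    simp only [hprev]
    module
  have hinv : 1 / r ≤ 1 := by rw [div_le_one hr0]; exact hr1
  cases M with
  | zero =>
    simp only [heavyBall, zero_sub, norm_neg, Nat.cast_zero, zero_div, neg_zero, Real.exp_zero,
      mul_one]
    have := norm_nonneg v
    nlinarith
  | succ t =>
    have hρ1 : ρ ≤ 1 := by
      have : 0 ≤ 1 / r := by positivity
      linarith
    have h1 := norm_le_of_second_order_recursion hT hρ hρ1 hTρ
      (e := fun t => (heavyBall H b lam (ρ ^ 2) t).v - v) rfl hrec t
    refine h1.trans ?_
    simp only [heavyBall, zero_sub, norm_neg]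
    refine mul_le_mul_of_nonneg_right ?_ (norm_nonneg v)
    have h2 : ρ ^ t ≤ Real.exp (-(t / r)) := by
      have h3 : ρ ≤ Real.exp (-(1 / r)) := by
        have := Real.add_one_le_exp (-(1 / r))
        linarith
      refine (pow_le_pow_left₀ hρ h3 t).trans_eq ?_
      rw [← Real.exp_nat_mul]
      ring_nf
    -- Half of the decay exp(-t/r) absorbs the factor linear in t, at the price of a factor of order
    -- r.
    have h4 : ((t : ℝ) + 1) ≤ 2 * r * Real.exp ((t + 1) / (2 * r)) := by
      have := Real.add_one_le_exp (((t : ℝ) + 1) / (2 * r))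
      have h5 : ((t : ℝ) + 1) / (2 * r) ≤ Real.exp ((t + 1) / (2 * r)) := by linarith
      rw [div_le_iff₀ (by positivity)] at h5
      linarith
    have h6 : (2 * (t : ℝ) + 3) ≤ 6 * r * Real.exp ((t + 1) / (2 * r)) := by
      have : (0 : ℝ) ≤ t := Nat.cast_nonneg t
      linarith
    refine (mul_le_mul h6 h2 (by positivity) (by positivity)).trans ?_
    rw [mul_assoc (6 * r), ← Real.exp_add]
    -- Because v^0 = v^1, M = t + 1 steps give only the power ρ^t; the shift costs exp(1/r) ≤ 3, and
    -- 6 · 3 = 18.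
    have h7 : ((t : ℝ) + 1) / (2 * r) + -(t / r) = 1 / r + -(((t + 1 : ℕ) : ℝ) / (2 * r)) := by
      push_cast
      field_simp
      ring
    rw [h7, Real.exp_add]
    have h8 : Real.exp (1 / r) ≤ 3 := by
      have := Real.exp_one_lt_d9
      have := Real.exp_le_exp.2 hinv
      linarith
    have h9 := Real.exp_pos (-(((t + 1 : ℕ) : ℝ) / (2 * r)))
    have h10 := mul_le_mul_of_nonneg_right h8 h9.le
    have := mul_le_mul_of_nonneg_left h10 (show 0 ≤ 6 * r by positivity)
    linarith

end HeavyBall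

/-! ### Linear convergence of the inner loop -/

section InnerLoop

variable {p q : ℕ}

/-- Linear convergence of the inner accelerated gradient descent. -/
theorem norm_agd_sub_le {g : Euc p → Euc q → ℝ} {L μ : ℝ} (hμ : 0 < μ) (hL : μ ≤ L) {x : Euc p}
    (hgrad : ∀ y, HasGradientAt (g x) (gradY g x y) y)
    (hsc : ∀ y u, g x y + inner ℝ (gradY g x y) (u - y) + μ / 2 * ‖u - y‖ ^ 2 ≤ g x u)
    (hsm : ∀ y u, ‖gradY g x y - gradY g x u‖ ≤ L * ‖y - u‖)
    {ys : Euc q} (hys : gradY g x ys = 0) (N : ℕ) :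
    ‖(agd g L μ x N).y - ys‖
      ≤ 2 * Real.sqrt (L / μ) * Real.exp (-(N / (2 * Real.sqrt (L / μ)))) * ‖ys‖ := by
  set r := Real.sqrt (L / μ) with hr
  have hr1 : 1 ≤ r := by
    rw [hr, Real.one_le_sqrt, one_le_div hμ]; exact hL
  have hr0 : 0 < r := by linarith
  have hrL : L = μ * r ^ 2 := by
    rw [hr, Real.sq_sqrt (div_nonneg (hμ.le.trans hL) hμ.le)]
    field_simp
  have hlow : ∀ u, μ / 2 * ‖u - ys‖ ^ 2 ≤ g x u - g x ys := by
    intro u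
    have := hsc ys u
    rw [hys, inner_zero_left] at this
    linarith
  set E0 := g x 0 - g x ys + μ / 2 * ‖0 - ys‖ ^ 2 with hE0
  have hE0nn : 0 ≤ E0 := by
    have := hlow 0
    have h2 : 0 ≤ μ / 2 * ‖0 - ys‖ ^ 2 := by positivity
    linarith
  have hE0le : E0 ≤ L * ‖ys‖ ^ 2 := by
    have h1 := le_add_inner_gradient_add_sq hgrad (fun u => hsm u ys) 0
    rw [hys, inner_zero_left] at h1
    rw [zero_sub, norm_neg] at h1 hE0
    have := mul_le_mul_of_nonneg_right hL (sq_nonneg ‖ys‖)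
    linarith
  -- The oracle is exact and the Lipschitz bound global, so δ = η = 0 and D is just the radius of
  -- the initial energy. The coefficient 2r/(r + 1) of `agd` is 1 + (r - 1)/(r + 1).
  have hmain := accelerated_gradient_inexact (φ := g x) (φ' := gradY g x) (G := gradY g x)
    (xs := ys) (r := r) (μ := μ) (D := √(2 / μ * (E0 + 0))) (δ := 0) (η := 0) hr1 hμ
    (Real.sqrt_nonneg _) le_rfl le_rfl hgrad hsc
    (fun y _ u => by rw [← hrL]; exact hsm u y) hys (fun y _ => by simp) (by simp)
    (x := fun t => (agd g L μ x t).s) (z := fun t => (agd g L μ x t).y) rfl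
    (fun k => by simp only [agd]; rw [← hrL])
    (fun k => by
      simp only [agd]
      rw [← hr, show 2 * r / (r + 1) = 1 + (r - 1) / (r + 1) by field_simp; ring])
    (by rw [Real.sq_sqrt (mul_nonneg (by positivity) (by linarith))]; rfl) N
  have h1 := hmain.2
  have h0 : (agd g L μ x 0).y = 0 := rfl
  simp only [h0, ← hE0, add_zero] at h1
  have h2 := hlow (agd g L μ x N).y
  have hpow : (1 - 1 / r) ^ N ≤ Real.exp (-(N / (2 * r))) ^ 2 := by
    have h3 : 1 - 1 / r ≤ Real.exp (-(1 / r)) := by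
      have := Real.add_one_le_exp (-(1 / r))
      linarith
    refine (pow_le_pow_left₀ ?_ h3 N).trans_eq ?_
    · rw [sub_nonneg, div_le_one hr0]; exact hr1
    · rw [← Real.exp_nat_mul, ← Real.exp_nat_mul]
      congr 1
      push_cast
      field_simp
  have hsq : ‖(agd g L μ x N).y - ys‖ ^ 2 ≤ (2 * r * Real.exp (-(N / (2 * r))) * ‖ys‖) ^ 2 := by
    have h4 : (1 - 1 / r) ^ N * E0 ≤ Real.exp (-(N / (2 * r))) ^ 2 * (L * ‖ys‖ ^ 2) :=
      mul_le_mul hpow hE0le hE0nn (by positivity)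
    have h5 : μ / 2 * ‖(agd g L μ x N).y - ys‖ ^ 2 ≤
        μ / 2 * (2 * r ^ 2 * Real.exp (-(N / (2 * r))) ^ 2 * ‖ys‖ ^ 2) := by
      refine h2.trans (h1.trans (h4.trans_eq ?_))
      rw [hrL]; ring
    have h6 := le_of_mul_le_mul_left h5 (by positivity)
    have h7 : 0 ≤ r ^ 2 * Real.exp (-(N / (2 * r))) ^ 2 * ‖ys‖ ^ 2 := by positivity
    have h8 : (2 * r * Real.exp (-(N / (2 * r))) * ‖ys‖) ^ 2 =
      4 * (r ^ 2 * Real.exp (-(N / (2 * r))) ^ 2 * ‖ys‖ ^ 2) := by ring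
    rw [h8]
    linarith
  exact (abs_le_of_sq_le_sq' hsq (by positivity)).2

end InnerLoop

/-! ### The hypergradient: formula, local smoothness and perturbation -/

noncomputable section

/-- Differentiability along a Lipschitz section of a function whose derivative depends on the
first component only. -/
lemma HasFDerivAt.comp_lipschitz_section {E F : Type*} [NormedAddCommGroup E] [NormedSpace ℝ E]
    [NormedAddCommGroup F] [NormedSpace ℝ F] {Ψ : E × F → ℝ} {ℓ : E →L[ℝ] ℝ} {s : E → F} {x : E}
    (h : HasFDerivAt Ψ (ℓ.comp (ContinuousLinearMap.fst ℝ E F)) (x, s x)) {K : ℝ}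
    (hs : ∀ x', ‖s x' - s x‖ ≤ K * ‖x' - x‖) : HasFDerivAt (fun x' => Ψ (x', s x')) ℓ x := by
  have hO : (fun x' => s x' - s x) =O[nhds x] fun x' => x' - x :=
    Asymptotics.IsBigO.of_bound K (Filter.Eventually.of_forall hs)
  have hcont : ContinuousAt s x := by
    have h1 : Filter.Tendsto (fun x' => x' - x) (nhds x) (nhds 0) := by
      have : ContinuousAt (fun x' : E => x' - x) x := by fun_prop
      simpa [ContinuousAt] using this
    have h2 := hO.trans_tendsto h1
    have h3 := h2.add_const (s x)
    simpa [ContinuousAt] using h3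
  have ht : Filter.Tendsto (fun x' => (x', s x')) (nhds x) (nhds (x, s x)) :=
    (continuousAt_id.prodMk hcont)
  rw [hasFDerivAt_iff_isLittleO]
  have h1 := (hasFDerivAt_iff_isLittleO.1 h).comp_tendsto ht
  have h2 := h1.trans_isBigO (k := fun x' => x' - x) (by
    exact (Asymptotics.isBigO_refl _ _).prod_left hO)
  exact h2

section Bilevel

variable {p q : ℕ} {f g : Euc p → Euc q → ℝ} {Lx Lxy Ly Ltxy Lty ρxy ρyy μ : ℝ}

/-- A solution `v` of the linear system `∇²_y g (x, y) v = ∇_y f (x, y)`. -/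
def linearSol (f g : Euc p → Euc q → ℝ) (x : Euc p) (y : Euc q) : Euc q :=
  Classical.epsilon (fun v => hessYY g x y v = gradY f x y)

/-- The hypergradient `∇ₓ f - ∇ₓ∇_y g (∇²_y g)⁻¹ ∇_y f` at `(x, y*(x))`. -/
def hyperGrad (f g : Euc p → Euc q → ℝ) (x : Euc p) : Euc p :=
  gradX f x (innerSol g x) - jacXY g x (innerSol g x) (linearSol f g x (innerSol g x))

namespace IsConvexStronglyConvex

lemma hasGradientAt_g (h : IsConvexStronglyConvex f g Lx Lxy Ly Ltxy Lty ρxy ρyy μ)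
    (x : Euc p) (y : Euc q) : HasGradientAt (g x) (gradY g x y) y := by
  have h1 : DifferentiableAt ℝ (fun z : Euc p × Euc q => g z.1 z.2) (x, y) :=
    (h.contDiff_g.differentiable one_ne_zero) _
  have h2 : DifferentiableAt ℝ (fun y' => g x y') y :=
    h1.comp y (f := fun y' => (x, y')) (by fun_prop)
  exact h2.hasGradientAt

lemma add_inner_gradY_le (h : IsConvexStronglyConvex f g Lx Lxy Ly Ltxy Lty ρxy ρyy μ)
    (x : Euc p) (y u : Euc q) :
    g x y + inner ℝ (gradY g x y) (u - y) + μ / 2 * ‖u - y‖ ^ 2 ≤ g x u :=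
  (h.strongConvex_g x).add_inner_gradient_le (h.hasGradientAt_g x y) u

lemma gradY_innerSol (h : IsConvexStronglyConvex f g Lx Lxy Ly Ltxy Lty ρxy ρyy μ) (hμ : 0 < μ)
    (x : Euc p) : gradY g x (innerSol g x) = 0 := by
  refine (h.hasGradientAt_g x _).eq_zero_of_forall_le (argminPt_le ?_)
  refine exists_forall_le_of_quadratic_lower_bound ?_ hμ (g := gradY g x 0) fun u => ?_
  · exact h.contDiff_g.continuous.comp (f := fun y' => (x, y')) (by fun_prop)
  · simpa using h.add_inner_gradY_le x 0 u

lemma strongMono_gradY (h : IsConvexStronglyConvex f g Lx Lxy Ly Ltxy Lty ρxy ρyy μ)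
    (x : Euc p) (y u : Euc q) :
    μ * ‖y - u‖ ^ 2 ≤ inner ℝ (gradY g x y - gradY g x u) (y - u) := by
  have h1 := h.add_inner_gradY_le x y u
  have h2 := h.add_inner_gradY_le x u y
  rw [← neg_sub y u, norm_neg, inner_neg_right] at h1
  rw [inner_sub_left]
  linarith

/-- Strong monotonicity and the Lipschitz bound are compared on a nonzero vector, which exists only
for q > 0. This gives κ_y ≥ 1. -/
lemma mu_le_Lty (h : IsConvexStronglyConvex f g Lx Lxy Ly Ltxy Lty ρxy ρyy μ) (hq : 0 < q) :
    μ ≤ Lty := by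
  have : Nonempty (Fin q) := ⟨⟨0, hq⟩⟩
  obtain ⟨v, hv⟩ := exists_ne (0 : Euc q)
  have hv' : 0 < ‖v‖ := norm_pos_iff.2 hv
  have h1 := h.strongMono_gradY 0 v 0
  have h2 := h.gradY_g_y 0 v 0
  have h3 := real_inner_le_norm (gradY g 0 v - gradY g 0 0) (v - 0)
  have h4 := mul_le_mul_of_nonneg_right h2 (norm_nonneg (v - 0))
  rw [sub_zero] at *
  have h5 : μ * ‖v‖ ^ 2 ≤ Lty * ‖v‖ ^ 2 := by linarith [h4, sq ‖v‖]
  exact le_of_mul_le_mul_right h5 (by positivity)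

/-- Apply strong monotonicity of ∇_y g (x', ·) between the two solutions: one of the gradients
vanishes, and the other is small because it vanishes when x' is replaced by x. -/
lemma norm_innerSol_sub_le (h : IsConvexStronglyConvex f g Lx Lxy Ly Ltxy Lty ρxy ρyy μ)
    (hμ : 0 < μ) (x x' : Euc p) :
    ‖innerSol g x - innerSol g x'‖ ≤ Ltxy / μ * ‖x - x'‖ := by
  set y := innerSol g x
  set y' := innerSol g x'
  have h1 := h.strongMono_gradY x' y y'
  rw [h.gradY_innerSol hμ x', sub_zero] at h1
  have h2 := h.gradY_g_x x' x y
  rw [h.gradY_innerSol hμ x, sub_zero, norm_sub_rev] at h2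
  have h3 := real_inner_le_norm (gradY g x' y) (y - y')
  have h4 := mul_le_mul_of_nonneg_right h2 (norm_nonneg (y - y'))
  rw [div_mul_eq_mul_div, le_div_iff₀ hμ]
  by_cases h0 : ‖y - y'‖ = 0
  · rw [h0, zero_mul]
    exact (norm_nonneg _).trans h2
  · refine le_of_mul_le_mul_right ?_ (lt_of_le_of_ne (norm_nonneg (y - y')) (Ne.symm h0))
    nlinarith

lemma hasFDerivAt_gradY (h : IsConvexStronglyConvex f g Lx Lxy Ly Ltxy Lty ρxy ρyy μ)
    (x : Euc p) (y : Euc q) : HasFDerivAt (fun y' => gradY g x y') (hessYY g x y) y := by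
  have h1 := h.differentiable_gradY_g (x, y)
  have h2 : DifferentiableAt ℝ (fun y' => gradY g x y') y :=
    h1.comp y (f := fun y' => (x, y')) (by fun_prop)
  exact h2.hasFDerivAt

lemma hessYY_symm (h : IsConvexStronglyConvex f g Lx Lxy Ly Ltxy Lty ρxy ρyy μ)
    (x : Euc p) (y v w : Euc q) :
    inner ℝ (hessYY g x y v) w = inner ℝ v (hessYY g x y w) := by
  -- The Riesz map as an ℝ-linear map; it turns the gradient into the derivative, to which symmetry
  -- of second derivatives applies.
  let D : Euc q →L[ℝ] StrongDual ℝ (Euc q) := LinearMap.toContinuousLinearMap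
    { toFun := fun u => innerSL ℝ u
      map_add' := fun u w => by simp
      map_smul' := fun c u => by simp }
  have h1 := second_derivative_symmetric (𝕜 := ℝ) (f := g x) (x := y)
    (f' := fun y' => D (gradY g x y'))
    (f'' := D.comp (hessYY g x y))
    (fun y' => (h.hasGradientAt_g x y').hasFDerivAt)
    (D.hasFDerivAt.comp y
      (h.hasFDerivAt_gradY x y)) v w
  simp [D] at h1
  rw [h1, real_inner_comm]

/-- Strong monotonicity between y + t v and y, divided by t², passes to the limit t → 0. -/
lemma hessYY_coercive (h : IsConvexStronglyConvex f g Lx Lxy Ly Ltxy Lty ρxy ρyy μ)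
    (x : Euc p) (y v : Euc q) : μ * ‖v‖ ^ 2 ≤ inner ℝ (hessYY g x y v) v := by
  have hd : HasDerivAt (fun t : ℝ => inner ℝ (gradY g x (y + t • v)) v)
      (inner ℝ (hessYY g x y v) v) 0 := by
    have h1 : HasDerivAt (fun s : ℝ => y + s • v) v 0 := by
      simpa using ((hasDerivAt_id (0 : ℝ)).smul_const v).const_add y
    have h2 : HasFDerivAt (fun y' => gradY g x y') (hessYY g x y) (y + (0 : ℝ) • v) := by
      simpa using h.hasFDerivAt_gradY x y
    have h3 := h2.comp_hasDerivAt (0 : ℝ) h1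
    simpa using h3.inner ℝ (hasDerivAt_const (0 : ℝ) v)
  refine ge_of_tendsto (hasDerivAt_iff_tendsto_slope.1 hd) ?_
  filter_upwards [self_mem_nhdsWithin] with t ht
  have ht' : t ≠ 0 := ht
  have h1 := h.strongMono_gradY x (y + t • v) y
  rw [add_sub_cancel_left, norm_smul, mul_pow, Real.norm_eq_abs, sq_abs, inner_smul_right] at h1
  rw [slope_def_field, zero_smul, add_zero, sub_zero, ← inner_sub_left]
  have h2 : 0 < t ^ 2 := by positivity
  refine le_of_mul_le_mul_left ?_ h2
  calc t ^ 2 * (μ * ‖v‖ ^ 2) = μ * (t ^ 2 * ‖v‖ ^ 2) := by ring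
    _ ≤ _ := h1
    _ = _ := by field_simp

lemma norm_hessYY_le (h : IsConvexStronglyConvex f g Lx Lxy Ly Ltxy Lty ρxy ρyy μ)
    (hL : 0 ≤ Lty) (x : Euc p) (y : Euc q) : ‖hessYY g x y‖ ≤ Lty :=
  norm_fderiv_le_of_lip' ℝ hL (Filter.Eventually.of_forall fun y' => h.gradY_g_y x y' y)

lemma inner_hessYY_le (h : IsConvexStronglyConvex f g Lx Lxy Ly Ltxy Lty ρxy ρyy μ)
    (hL : 0 ≤ Lty) (x : Euc p) (y v : Euc q) :
    inner ℝ (hessYY g x y v) v ≤ Lty * ‖v‖ ^ 2 := by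
  have h1 := real_inner_le_norm (hessYY g x y v) v
  have h2 := (hessYY g x y).le_of_opNorm_le (h.norm_hessYY_le hL x y) v
  have h3 := mul_le_mul_of_nonneg_right h2 (norm_nonneg v)
  nlinarith

lemma norm_jacXY_le (h : IsConvexStronglyConvex f g Lx Lxy Ly Ltxy Lty ρxy ρyy μ)
    (hL : 0 ≤ Ltxy) (x : Euc p) (y : Euc q) : ‖jacXY g x y‖ ≤ Ltxy := by
  rw [jacXY, LinearIsometryEquiv.norm_map]
  exact norm_fderiv_le_of_lip' ℝ hL (Filter.Eventually.of_forall fun x' => h.gradY_g_x x' x y)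

lemma mul_norm_le_norm_hessYY (h : IsConvexStronglyConvex f g Lx Lxy Ly Ltxy Lty ρxy ρyy μ)
    (x : Euc p) (y v : Euc q) : μ * ‖v‖ ≤ ‖hessYY g x y v‖ := by
  have h1 := h.hessYY_coercive x y v
  have h2 := real_inner_le_norm (hessYY g x y v) v
  by_cases h0 : ‖v‖ = 0
  · rw [h0, mul_zero]; positivity
  · refine le_of_mul_le_mul_right ?_ (lt_of_le_of_ne (norm_nonneg v) (Ne.symm h0))
    nlinarith

lemma hessYY_linearSol (h : IsConvexStronglyConvex f g Lx Lxy Ly Ltxy Lty ρxy ρyy μ) (hμ : 0 < μ)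
    (x : Euc p) (y : Euc q) : hessYY g x y (linearSol f g x y) = gradY f x y := by
  refine Classical.epsilon_spec (p := fun v => hessYY g x y v = gradY f x y) ?_
  have hinj : Function.Injective (hessYY g x y : Euc q →ₗ[ℝ] Euc q) := by
    rw [← LinearMap.ker_eq_bot, LinearMap.ker_eq_bot']
    intro v hv
    have h1 := h.mul_norm_le_norm_hessYY x y v
    rw [ContinuousLinearMap.coe_coe] at hv
    rw [hv, norm_zero] at h1
    exact norm_le_zero_iff.1 (nonpos_of_mul_nonpos_right h1 hμ)
  exact LinearMap.injective_iff_surjective.1 hinj (gradY f x y)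

lemma norm_linearSol_le (h : IsConvexStronglyConvex f g Lx Lxy Ly Ltxy Lty ρxy ρyy μ) (hμ : 0 < μ)
    (x : Euc p) (y : Euc q) : ‖linearSol f g x y‖ ≤ ‖gradY f x y‖ / μ := by
  rw [le_div_iff₀ hμ, mul_comm, ← h.hessYY_linearSol hμ x y]
  exact h.mul_norm_le_norm_hessYY x y _

/-- Perturbation of the solution of the linear system. -/
lemma norm_linearSol_sub_le (h : IsConvexStronglyConvex f g Lx Lxy Ly Ltxy Lty ρxy ρyy μ)
    (hμ : 0 < μ) (hρ : 0 ≤ ρyy) (x x' : Euc p) (y y' : Euc q) {s : ℝ}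
    (hs : Real.sqrt (‖x' - x‖ ^ 2 + ‖y' - y‖ ^ 2) ≤ s) :
    ‖linearSol f g x' y' - linearSol f g x y‖
      ≤ (‖gradY f x' y' - gradY f x y‖ + ρyy * s * (‖gradY f x y‖ / μ)) / μ := by
  rw [le_div_iff₀ hμ, mul_comm]
  refine (h.mul_norm_le_norm_hessYY x' y' _).trans ?_
  -- With H, b and H', b' the two systems, H'(v' - v) = (b' - b) - (H' - H)v. Thus only the unprimed
  -- solution v has to be bounded.
  have h1 : hessYY g x' y' (linearSol f g x' y' - linearSol f g x y)
      = (gradY f x' y' - gradY f x y) - (hessYY g x' y' - hessYY g x y) (linearSol f g x y) := by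
    rw [map_sub, h.hessYY_linearSol hμ, sub_apply, h.hessYY_linearSol hμ]
    abel
  rw [h1]
  refine (norm_sub_le _ _).trans (add_le_add le_rfl ?_)
  refine (ContinuousLinearMap.le_opNorm _ _).trans ?_
  have h2 := (h.hessYY_g x' x y' y).trans (mul_le_mul_of_nonneg_left hs hρ)
  exact mul_le_mul h2 (h.norm_linearSol_le hμ x y) (norm_nonneg _)
    (mul_nonneg hρ ((Real.sqrt_nonneg _).trans hs))

/-- Perturbation of the Jacobian-vector product with the solution of the linear system. -/
lemma norm_jacXY_linearSol_sub_le (h : IsConvexStronglyConvex f g Lx Lxy Ly Ltxy Lty ρxy ρyy μ)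
    (hμ : 0 < μ) (hL : 0 ≤ Ltxy) (hρ : 0 ≤ ρyy) (hρ' : 0 ≤ ρxy) (x x' : Euc p) (y y' : Euc q)
    {s : ℝ} (hs : Real.sqrt (‖x' - x‖ ^ 2 + ‖y' - y‖ ^ 2) ≤ s) :
    ‖jacXY g x' y' (linearSol f g x' y') - jacXY g x y (linearSol f g x y)‖
      ≤ Ltxy * ((‖gradY f x' y' - gradY f x y‖ + ρyy * s * (‖gradY f x y‖ / μ)) / μ)
        + ρxy * s * (‖gradY f x y‖ / μ) := by
  have h1 : jacXY g x' y' (linearSol f g x' y') - jacXY g x y (linearSol f g x y)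
      = jacXY g x' y' (linearSol f g x' y' - linearSol f g x y)
        + (jacXY g x' y' - jacXY g x y) (linearSol f g x y) := by
    rw [map_sub, sub_apply]
    abel
  rw [h1]
  refine (norm_add_le _ _).trans (add_le_add ?_ ?_)
  · refine (ContinuousLinearMap.le_opNorm _ _).trans ?_
    exact mul_le_mul (h.norm_jacXY_le hL x' y') (h.norm_linearSol_sub_le hμ hρ x x' y y' hs)
      (norm_nonneg _) hL
  · refine (ContinuousLinearMap.le_opNorm _ _).trans ?_
    have h2 := (h.jacXY_g x' x y' y).trans (mul_le_mul_of_nonneg_left hs hρ')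
    exact mul_le_mul h2 (h.norm_linearSol_le hμ x y) (norm_nonneg _)
      (mul_nonneg hρ' ((Real.sqrt_nonneg _).trans hs))

lemma hasFDerivAt_f (h : IsConvexStronglyConvex f g Lx Lxy Ly Ltxy Lty ρxy ρyy μ)
    (x : Euc p) (y : Euc q) :
    HasFDerivAt (fun z : Euc p × Euc q => f z.1 z.2)
      ((innerSL ℝ (gradX f x y)).comp (ContinuousLinearMap.fst ℝ (Euc p) (Euc q))
        + (innerSL ℝ (gradY f x y)).comp (ContinuousLinearMap.snd ℝ (Euc p) (Euc q))) (x, y) := by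
  have h1 : DifferentiableAt ℝ (fun z : Euc p × Euc q => f z.1 z.2) (x, y) :=
    (h.contDiff_f.differentiable one_ne_zero) _
  have h2 : HasFDerivAt (fun x' => f x' y) _ x :=
    h1.hasFDerivAt.comp (f := fun x' => (x', y)) x (hasFDerivAt_prodMk_left x y)
  have h3 : HasFDerivAt (fun y' => f x y') _ y :=
    h1.hasFDerivAt.comp (f := fun y' => (x, y')) y (hasFDerivAt_prodMk_right x y)
  have h4 := h2.differentiableAt.hasGradientAt.hasFDerivAt.unique h2
  have h5 := h3.differentiableAt.hasGradientAt.hasFDerivAt.unique h3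
  refine h1.hasFDerivAt.congr_fderiv ?_
  ext z
  · have := congrArg (fun l => l z) h4
    simpa [gradX] using this.symm
  · have := congrArg (fun l => l z) h5
    simpa [gradY] using this.symm

lemma hasFDerivAt_gradY_prod (h : IsConvexStronglyConvex f g Lx Lxy Ly Ltxy Lty ρxy ρyy μ)
    (x : Euc p) (y : Euc q) :
    HasFDerivAt (fun z : Euc p × Euc q => gradY g z.1 z.2)
      ((ContinuousLinearMap.adjoint (jacXY g x y)).comp
          (ContinuousLinearMap.fst ℝ (Euc p) (Euc q))
        + (hessYY g x y).comp (ContinuousLinearMap.snd ℝ (Euc p) (Euc q))) (x, y) := by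
  have h1 := h.differentiable_gradY_g (x, y)
  have h2 : HasFDerivAt (fun x' => gradY g x' y) _ x :=
    h1.hasFDerivAt.comp (f := fun x' => (x', y)) x (hasFDerivAt_prodMk_left x y)
  have h3 : HasFDerivAt (fun y' => gradY g x y') _ y :=
    h1.hasFDerivAt.comp (f := fun y' => (x, y')) y (hasFDerivAt_prodMk_right x y)
  have h4 := h2.fderiv
  have h5 := h3.fderiv
  refine h1.hasFDerivAt.congr_fderiv ?_
  rw [jacXY, ContinuousLinearMap.adjoint_adjoint, hessYY, h4, h5]
  have h0 : fderiv ℝ (fun z : Euc p × Euc q => gradY g z.1 z.2) (x, y) (0, 0) = 0 := map_zero _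
  ext z <;> simp [h0]

/-- The formula for the gradient of the total objective. -/
theorem hasGradientAt_totalObj (h : IsConvexStronglyConvex f g Lx Lxy Ly Ltxy Lty ρxy ρyy μ)
    (hμ : 0 < μ) (x : Euc p) : HasGradientAt (totalObj f g) (hyperGrad f g x) x := by
  set y := innerSol g x with hy
  set v := linearSol f g x y with hv
  -- The Lagrangian f - ⟨v, ∇_y g⟩ with v frozen at its value at x. Its y-derivative at (x, y*(x))
  -- vanishes by the linear system and symmetry of the Hessian, and its second term vanishes along
  -- y*.
  have h1 := (h.hasFDerivAt_f x y).sub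
    ((innerSL ℝ v).hasFDerivAt.comp (x, y) (h.hasFDerivAt_gradY_prod x y))
  have h2 := HasFDerivAt.comp_lipschitz_section (s := innerSol g) (x := x)
    (ℓ := innerSL ℝ (hyperGrad f g x)) (h1.congr_fderiv ?_)
    (fun x' => h.norm_innerSol_sub_le hμ x' x)
  · rw [hasGradientAt_iff_hasFDerivAt]
    refine h2.congr_of_eventuallyEq (Filter.Eventually.of_forall fun x' => ?_)
    simp [totalObj, h.gradY_innerSol hμ x']
  · ext z
    · simp [hyperGrad, ContinuousLinearMap.adjoint_inner_right, ← hy, ← hv]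
    · have h3 : inner ℝ (gradY f x y) z = inner ℝ v (hessYY g x y z) := by
        rw [← h.hessYY_symm, hv, h.hessYY_linearSol hμ]
      simp [h3]

/-- Local smoothness of the total objective. -/
theorem norm_hyperGrad_sub_le (h : IsConvexStronglyConvex f g Lx Lxy Ly Ltxy Lty ρxy ρyy μ)
    (hμ : 0 < μ) (hLxy : 0 ≤ Lxy) (hLy : 0 ≤ Ly) (hL : 0 ≤ Ltxy) (hρ : 0 ≤ ρyy) (hρ' : 0 ≤ ρxy)
    (x x' : Euc p) :
    ‖hyperGrad f g x' - hyperGrad f g x‖ ≤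
      (Lx + 2 * Lxy * Ltxy / μ + Ly * Ltxy ^ 2 / μ ^ 2
        + (Ltxy * ρyy / μ ^ 2 + ρxy / μ) * (1 + Ltxy / μ) * ‖gradY f x (innerSol g x)‖)
        * ‖x' - x‖ := by
  set y := innerSol g x with hy
  set y' := innerSol g x' with hy'
  set d := ‖x' - x‖ with hd
  have hd0 : 0 ≤ d := norm_nonneg _
  have hyy : ‖y' - y‖ ≤ Ltxy / μ * d := h.norm_innerSol_sub_le hμ x' x
  have hs : Real.sqrt (d ^ 2 + ‖y' - y‖ ^ 2) ≤ (1 + Ltxy / μ) * d := by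
    refine Real.sqrt_le_iff.2 ⟨by positivity, ?_⟩
    have := norm_nonneg (y' - y)
    nlinarith
  -- In this order of the arguments only the gradient at the base point x enters, so x' may be
  -- arbitrarily far away.
  have h1 := h.norm_jacXY_linearSol_sub_le hμ hL hρ hρ' x x' y y' hs
  have h2 : ‖gradY f x' y' - gradY f x y‖ ≤ Lxy * d + Ly * (Ltxy / μ * d) := by
    have e : gradY f x' y' - gradY f x y
        = (gradY f x' y' - gradY f x y') + (gradY f x y' - gradY f x y) := by abel
    rw [e]
    exact (norm_add_le _ _).trans (add_le_add (h.gradY_f_x x' x y')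
      ((h.gradY_f_y x y' y).trans (mul_le_mul_of_nonneg_left hyy hLy)))
  have h3 : ‖gradX f x' y' - gradX f x y‖ ≤ Lx * d + Lxy * (Ltxy / μ * d) := by
    have e : gradX f x' y' - gradX f x y
        = (gradX f x' y' - gradX f x y') + (gradX f x y' - gradX f x y) := by abel
    rw [e]
    exact (norm_add_le _ _).trans (add_le_add (h.gradX_f_x x' x y')
      ((h.gradX_f_y x y' y).trans (mul_le_mul_of_nonneg_left hyy hLxy)))
  have e : hyperGrad f g x' - hyperGrad f g x = (gradX f x' y' - gradX f x y)
      - (jacXY g x' y' (linearSol f g x' y') - jacXY g x y (linearSol f g x y)) := by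
    rw [hyperGrad, hyperGrad]; abel
  rw [e]
  refine (norm_sub_le _ _).trans ((add_le_add h3 h1).trans ?_)
  set β := ‖gradY f x y‖
  have h4 : Ltxy * ((‖gradY f x' y' - gradY f x y‖ + ρyy * ((1 + Ltxy / μ) * d) * (β / μ)) / μ)
      ≤ Ltxy * ((Lxy * d + Ly * (Ltxy / μ * d) + ρyy * ((1 + Ltxy / μ) * d) * (β / μ)) / μ) := by
    gcongr
  refine (add_le_add le_rfl (add_le_add h4 le_rfl)).trans_eq ?_
  field_simp
  ring

/-- The error of the hypergradient estimate built from approximations `y`, `v` of the inner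
solution and of the solution of the linear system. -/
theorem norm_hyperGrad_estimate_sub_le
    (h : IsConvexStronglyConvex f g Lx Lxy Ly Ltxy Lty ρxy ρyy μ)
    (hμ : 0 < μ) (hL : 0 ≤ Ltxy) (hρ : 0 ≤ ρyy) (hρ' : 0 ≤ ρxy)
    (x : Euc p) (y v : Euc q) :
    ‖gradX f x y - jacXY g x y v - hyperGrad f g x‖ ≤
      (Lxy + Ltxy * Ly / μ + (Ltxy * ρyy / μ ^ 2 + ρxy / μ) * ‖gradY f x (innerSol g x)‖)
        * ‖y - innerSol g x‖ + Ltxy * ‖v - linearSol f g x y‖ := by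
  set ys := innerSol g x with hys
  set a := ‖y - ys‖ with ha
  have hs : Real.sqrt (‖x - x‖ ^ 2 + ‖y - ys‖ ^ 2) ≤ a := by
    rw [sub_self, norm_zero, zero_pow two_ne_zero, zero_add, Real.sqrt_sq (norm_nonneg _)]
  have h1 := h.norm_jacXY_linearSol_sub_le hμ hL hρ hρ' x x ys y hs
  have h2 := h.gradY_f_y x y ys
  have h3 := h.gradX_f_y x y ys
  have h4 : ‖jacXY g x y (v - linearSol f g x y)‖ ≤ Ltxy * ‖v - linearSol f g x y‖ :=
    (jacXY g x y).le_of_opNorm_le (h.norm_jacXY_le hL x y) _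
  have e : gradX f x y - jacXY g x y v - hyperGrad f g x = (gradX f x y - gradX f x ys)
      - (jacXY g x y (linearSol f g x y) - jacXY g x ys (linearSol f g x ys))
      - jacXY g x y (v - linearSol f g x y) := by
    rw [hyperGrad, map_sub]; abel
  rw [e]
  refine (norm_sub_le _ _).trans ((add_le_add ((norm_sub_le _ _).trans (add_le_add h3 h1))
    h4).trans ?_)
  set β := ‖gradY f x ys‖
  have h5 : Ltxy * ((‖gradY f x y - gradY f x ys‖ + ρyy * a * (β / μ)) / μ)
      ≤ Ltxy * ((Ly * a + ρyy * a * (β / μ)) / μ) := by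
    gcongr
  refine (add_le_add (add_le_add le_rfl (add_le_add h5 le_rfl)) le_rfl).trans_eq ?_
  field_simp
  ring

end IsConvexStronglyConvex

end Bilevel

end

/-! ### Convergence and oracle count of AccBiO for a strongly convex objective -/

section Outer

variable {p q : ℕ} {f g : Euc p → Euc q → ℝ} {Lx Lxy Ly Ltxy Lty ρxy ρyy μ : ℝ}

/-- Radius of the ball around the minimizer that contains the iterates `z_k`. -/
noncomputable def iterateRadius (f g : Euc p → Euc q → ℝ) (μx ε : ℝ) (xs : Euc p) : ℝ :=
  Real.sqrt (2 / μx * (totalObj f g 0 - totalObj f g xs) + ‖xs‖ ^ 2 + ε / μx)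

lemma le_smoothnessParam (hμ : 0 < μ) (hLxy : 0 ≤ Lxy) (hLy : 0 ≤ Ly) (hL : 0 ≤ Ltxy)
    (hρ : 0 ≤ ρyy) (hρ' : 0 ≤ ρxy) (f g : Euc p → Euc q → ℝ) (μx ε : ℝ) (xs : Euc p) :
    Lx ≤ smoothnessParam f g Lx Lxy Ly Ltxy ρxy ρyy μ μx ε xs := by
  simp only [smoothnessParam, add_assoc]
  refine le_add_of_nonneg_right ?_
  positivity

lemma div_le_regSmoothness (hμ : 0 < μ) (hLx : 0 ≤ Lx) (hLxy : 0 ≤ Lxy) (hLy : 0 ≤ Ly)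
    (hL : 0 ≤ Ltxy) (hρ : 0 ≤ ρyy) (hρ' : 0 ≤ ρxy) (f g : Euc p → Euc q → ℝ) (ε R ε' : ℝ) :
    ε / R ≤ regSmoothness f g Lx Lxy Ly Ltxy ρxy ρyy μ ε R ε' :=
  (le_add_of_nonneg_left hLx).trans (le_smoothnessParam hμ hLxy hLy hL hρ hρ' _ _ _ _ _)

namespace IsConvexStronglyConvex

lemma norm_gradY_innerSol_le (h : IsConvexStronglyConvex f g Lx Lxy Ly Ltxy Lty ρxy ρyy μ)
    (hμ : 0 < μ) (hLy : 0 ≤ Ly) (x xs : Euc p) :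
    ‖gradY f x (innerSol g x)‖
      ≤ ‖gradY f xs (innerSol g xs)‖ + (Lxy + Ly * Ltxy / μ) * ‖x - xs‖ := by
  have h1 := h.gradY_f_x x xs (innerSol g x)
  have h2 := (h.gradY_f_y xs (innerSol g x) (innerSol g xs)).trans
    (mul_le_mul_of_nonneg_left (h.norm_innerSol_sub_le hμ x xs) hLy)
  have e : gradY f x (innerSol g x) = gradY f xs (innerSol g xs)
      + (gradY f x (innerSol g x) - gradY f xs (innerSol g x))
      + (gradY f xs (innerSol g x) - gradY f xs (innerSol g xs)) := by abel
  rw [e]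
  refine (norm_add₃_le).trans ((add_le_add (add_le_add le_rfl h1) h2).trans_eq ?_)
  ring

lemma norm_innerSol_le (h : IsConvexStronglyConvex f g Lx Lxy Ly Ltxy Lty ρxy ρyy μ)
    (hμ : 0 < μ) (x xs : Euc p) :
    ‖innerSol g x‖ ≤ ‖innerSol g xs‖ + Ltxy / μ * ‖x - xs‖ := by
  have h1 := h.norm_innerSol_sub_le hμ x xs
  have h2 := norm_sub_norm_le (innerSol g x) (innerSol g xs)
  linarith

/-- The parameter `L_Φ` is a smoothness constant of `Φ` at base points near the minimizer. -/
lemma norm_hyperGrad_sub_le_smoothnessParam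
    (h : IsConvexStronglyConvex f g Lx Lxy Ly Ltxy Lty ρxy ρyy μ)
    (hμ : 0 < μ) (hLxy : 0 ≤ Lxy) (hLy : 0 ≤ Ly) (hL : 0 ≤ Ltxy) (hρ : 0 ≤ ρyy) (hρ' : 0 ≤ ρxy)
    {μx ε : ℝ} {xs x : Euc p} (hx : ‖x - xs‖ ≤ 3 * iterateRadius f g μx ε xs) (u : Euc p) :
    ‖hyperGrad f g u - hyperGrad f g x‖
      ≤ smoothnessParam f g Lx Lxy Ly Ltxy ρxy ρyy μ μx ε xs * ‖u - x‖ := by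
  refine (h.norm_hyperGrad_sub_le hμ hLxy hLy hL hρ hρ' x u).trans
    (mul_le_mul_of_nonneg_right ?_ (norm_nonneg _))
  have h1 := h.norm_gradY_innerSol_le hμ hLy x xs
  -- The factor 3 in `smoothnessParam` is the 3D within which the extrapolated points x_k stay.
  have h2 : ‖gradY f x (innerSol g x)‖ ≤ ‖gradY f xs (innerSol g xs)‖
      + (Lxy + Ly * Ltxy / μ) * (3 * iterateRadius f g μx ε xs) :=
    h1.trans (add_le_add le_rfl (mul_le_mul_of_nonneg_left hx (by positivity)))
  have h3 := mul_le_mul_of_nonneg_left h2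
    (show 0 ≤ (Ltxy * ρyy / μ ^ 2 + ρxy / μ) * (1 + Ltxy / μ) by positivity)
  rw [smoothnessParam]
  rw [iterateRadius] at h3
  refine (add_le_add le_rfl h3).trans_eq ?_
  ring

/-- Error of the hypergradient estimate of AccBiO at a point of a ball around `xs`. -/
lemma norm_accBiO_estimate_sub_le
    (h : IsConvexStronglyConvex f g Lx Lxy Ly Ltxy Lty ρxy ρyy μ)
    (hμ : 0 < μ) (hLty : μ ≤ Lty) (hLxy : 0 ≤ Lxy) (hLy : 0 ≤ Ly) (hL : 0 ≤ Ltxy) (hρ : 0 ≤ ρyy)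
    (hρ' : 0 ≤ ρxy) {x : Euc p} {β Y : ℝ} (hβ : ‖gradY f x (innerSol g x)‖ ≤ β)
    (hY : ‖innerSol g x‖ ≤ Y) (M N : ℕ) {r : ℝ} (hr : Real.sqrt (Lty / μ) = r) :
    ‖gradX f x (agd g Lty μ x N).y - jacXY g x (agd g Lty μ x N).y
        (heavyBall (hessYY g x (agd g Lty μ x N).y) (gradY f x (agd g Lty μ x N).y)
          (hbLam Lty μ) (hbTheta Lty μ) M).v - hyperGrad f g x‖ ≤
      (Lxy + Ltxy * Ly / μ + (Ltxy * ρyy / μ ^ 2 + ρxy / μ) * β)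
          * (2 * r * Real.exp (-(N / (2 * r))) * Y)
        + Ltxy * (18 * r * Real.exp (-(M / (2 * r))) * ((β + Ly * (2 * r * Y)) / μ)) := by
  have hr0 : 0 ≤ r := hr ▸ Real.sqrt_nonneg _
  have hY0 : 0 ≤ Y := (norm_nonneg _).trans hY
  set y := (agd g Lty μ x N).y with hy
  have hLty0 : 0 ≤ Lty := hμ.le.trans hLty
  have ha : ‖y - innerSol g x‖ ≤ 2 * r * Real.exp (-(N / (2 * r))) * Y := by
    have := norm_agd_sub_le hμ hLty (h.hasGradientAt_g x) (h.add_inner_gradY_le x)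
      (fun y u => h.gradY_g_y x y u) (h.gradY_innerSol hμ x) N
    rw [hr] at this
    exact this.trans (mul_le_mul_of_nonneg_left hY (by positivity))
  -- Dropping the exponential bounds the right-hand side of the linear system independently of N.
  have ha' : 2 * r * Real.exp (-(N / (2 * r))) * Y ≤ 2 * r * Y := by
    refine mul_le_mul_of_nonneg_right (mul_le_of_le_one_right (by positivity) ?_) hY0
    rw [Real.exp_le_one_iff, neg_nonpos]
    positivity
  have hb : ‖gradY f x y‖ ≤ β + Ly * (2 * r * Y) := by
    have h1 := h.gradY_f_y x y (innerSol g x)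
    have h2 := norm_sub_norm_le (gradY f x y) (gradY f x (innerSol g x))
    have h3 := mul_le_mul_of_nonneg_left (ha.trans ha') hLy
    linarith
  have hv : ‖linearSol f g x y‖ ≤ (β + Ly * (2 * r * Y)) / μ :=
    (h.norm_linearSol_le hμ x y).trans (div_le_div_of_nonneg_right hb hμ.le)
  have hhb := norm_heavyBall_sub_le hμ hLty (h.hessYY_symm x y) (h.hessYY_coercive x y)
    (h.inner_hessYY_le hLty0 x y) (h.hessYY_linearSol hμ x y) M
  rw [hr] at hhb
  refine (h.norm_hyperGrad_estimate_sub_le hμ hL hρ hρ' x y _).trans (add_le_add ?_ ?_)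
  · have hβ0 : 0 ≤ β := (norm_nonneg _).trans hβ
    refine mul_le_mul ?_ ha (norm_nonneg _) (by positivity)
    exact add_le_add le_rfl (mul_le_mul_of_nonneg_left hβ (by positivity))
  · exact mul_le_mul_of_nonneg_left (hhb.trans (mul_le_mul_of_nonneg_left hv (by positivity))) hL

/-- Convergence of AccBiO for a strongly convex total objective. -/
theorem accBiO_gap_le (h : IsConvexStronglyConvex f g Lx Lxy Ly Ltxy Lty ρxy ρyy μ)
    (hμ : 0 < μ) (hLty : μ ≤ Lty) (hLxy : 0 ≤ Lxy) (hLy : 0 ≤ Ly) (hL : 0 ≤ Ltxy) (hρ : 0 ≤ ρyy)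
    (hρ' : 0 ≤ ρxy) {μx ε : ℝ} (hμx : 0 < μx) (hμxL : μx ≤ Lx) (hε : 0 < ε)
    (hsc : StrongConvexOn univ μx (totalObj f g)) {xs : Euc p}
    (hxs : ∀ u, totalObj f g xs ≤ totalObj f g u)
    {L D r β Y δ : ℝ} (hLdef : smoothnessParam f g Lx Lxy Ly Ltxy ρxy ρyy μ μx ε xs = L)
    (hD : iterateRadius f g μx ε xs = D) (hr : Real.sqrt (Lty / μ) = r) (hδ : 0 ≤ δ)
    (hδε : δ * (7 * D + δ / L) ≤ ε / 2 / Real.sqrt (L / μx))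
    (hβ : ‖gradY f xs (innerSol g xs)‖ + (Lxy + Ly * Ltxy / μ) * (3 * D) ≤ β)
    (hY : ‖innerSol g xs‖ + Ltxy / μ * (3 * D) ≤ Y) (M N : ℕ)
    (hMN : (Lxy + Ltxy * Ly / μ + (Ltxy * ρyy / μ ^ 2 + ρxy / μ) * β)
          * (2 * r * Real.exp (-(N / (2 * r))) * Y)
        + Ltxy * (18 * r * Real.exp (-(M / (2 * r))) * ((β + Ly * (2 * r * Y)) / μ)) ≤ δ) (K : ℕ) :
    ‖(accBiO f g Lty μ L μx M N K).z - xs‖ ≤ D ∧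
      totalObj f g (accBiO f g Lty μ L μx M N K).z - totalObj f g xs ≤
        (1 - 1 / Real.sqrt (L / μx)) ^ K
          * (totalObj f g 0 - totalObj f g xs + μx / 2 * ‖xs‖ ^ 2) + ε / 2 := by
  have hμxL' : μx ≤ L :=
    hμxL.trans (hLdef ▸ le_smoothnessParam hμ hLxy hLy hL hρ hρ' f g μx ε xs)
  set R := Real.sqrt (L / μx) with hR
  have hR1 : 1 ≤ R := by
    rw [hR, Real.one_le_sqrt, one_le_div hμx]; exact hμxL'
  have hRL : μx * R ^ 2 = L := by
    rw [hR, Real.sq_sqrt (div_nonneg (hμx.le.trans hμxL') hμx.le)]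
    field_simp
  have hgrad := h.hasGradientAt_totalObj hμ
  have hD0 : 0 ≤ D := hD ▸ Real.sqrt_nonneg _
  have hΦ0 := hxs 0
  have hmain := accelerated_gradient_inexact (φ := totalObj f g) (φ' := hyperGrad f g)
    (G := fun x => gradX f x (agd g Lty μ x N).y - jacXY g x (agd g Lty μ x N).y
        (heavyBall (hessYY g x (agd g Lty μ x N).y) (gradY f x (agd g Lty μ x N).y)
          (hbLam Lty μ) (hbTheta Lty μ) M).v)
    (xs := xs) (r := R) (μ := μx) (D := D) (δ := δ) (η := ε / 2) hR1 hμx hD0 hδ (by positivity)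
    hgrad (fun x u => hsc.add_inner_gradient_le (hgrad x) u)
    (fun x hx u => by
      rw [hRL, ← hLdef]
      exact h.norm_hyperGrad_sub_le_smoothnessParam hμ hLxy hLy hL hρ hρ' (hD ▸ hx) u)
    ((hgrad xs).eq_zero_of_forall_le hxs)
    (fun x hx => by
      refine (h.norm_accBiO_estimate_sub_le hμ hLty hLxy hLy hL hρ hρ' (β := β) (Y := Y)
        ?_ ?_ M N hr).trans hMN
      · refine (h.norm_gradY_innerSol_le hμ hLy x xs).trans (le_trans ?_ hβ)
        exact add_le_add le_rfl (mul_le_mul_of_nonneg_left hx (by positivity))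
      · refine (h.norm_innerSol_le hμ x xs).trans (le_trans ?_ hY)
        exact add_le_add le_rfl (mul_le_mul_of_nonneg_left hx (by positivity)))
    (by rw [hRL]; exact hδε)
    (x := fun k => (accBiO f g Lty μ L μx M N k).x) (z := fun k => (accBiO f g Lty μ L μx M N k).z)
    rfl
    (fun k => by simp only [accBiO, hRL])
    (fun k => by simp only [accBiO, ← hR])
    (by
      have h0 : (accBiO f g Lty μ L μx M N 0).z = 0 := rfl
      -- `iterateRadius` squared is exactly 2/μx times the initial energy plus η = ε/2.
      rw [← hD, iterateRadius, Real.sq_sqrt]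
      · simp only [h0, zero_sub, norm_neg]
        apply le_of_eq
        field_simp
      · have : 0 ≤ 2 / μx * (totalObj f g 0 - totalObj f g xs) :=
          mul_nonneg (by positivity) (by linarith)
        positivity) K
  have h0 : (accBiO f g Lty μ L μx M N 0).z = 0 := rfl
  simpa only [h0, zero_sub, norm_neg] using hmain

end IsConvexStronglyConvex

/-- Number of oracle calls of AccBiO. -/
lemma cost_accBiO_le {τ : ℝ} (hτ : 0 ≤ τ) (f g : Euc p → Euc q → ℝ) (Lty μ L μx : ℝ) (M N K : ℕ) :
    (accBiO f g Lty μ L μx M N K).count.cost τ ≤ K * (τ * (1 + M) + (N + 2)) := by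
  have hagd : ∀ x, (agd g Lty μ x N).nG = N := by
    intro x
    induction N with
    | zero => rfl
    | succ N ih => simp [agd, ih]
  have hhb : ∀ (H : Euc q →L[ℝ] Euc q) b lam θ, (heavyBall H b lam θ M).nH ≤ M := by
    intro H b lam θ
    induction M with
    | zero => simp [heavyBall]
    | succ M ih =>
      cases M with
      | zero => simp [heavyBall]
      | succ M => rw [heavyBall]; simpa using ih
  induction K with
  | zero => simp [accBiO, OracleCount.cost]
  | succ K ih =>
    rw [OracleCount.cost] at ih ⊢
    simp only [accBiO, hagd]
    set st := accBiO f g Lty μ L μx M N K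
    have h1 : ((heavyBall (hessYY g st.x (agd g Lty μ st.x N).y)
      (gradY f st.x (agd g Lty μ st.x N).y) (hbLam Lty μ) (hbTheta Lty μ) M).nH : ℝ) ≤ M := by
      exact_mod_cast hhb _ _ _ _
    have h2 := mul_le_mul_of_nonneg_left h1 hτ
    push_cast
    linarith

end Outer

/-! ### The regularized problem -/

section Regularization

variable {p q : ℕ} {f g : Euc p → Euc q → ℝ} {Lx Lxy Ly Ltxy Lty ρxy ρyy μ ε R : ℝ}

lemma gradY_regularize (f : Euc p → Euc q → ℝ) (ε R : ℝ) (x : Euc p) (y : Euc q) :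
    gradY (regularize f ε R) x y = gradY f x y := by
  simp only [gradY, regularize, gradient, fderiv_add_const]

lemma totalObj_regularize (f g : Euc p → Euc q → ℝ) (ε R : ℝ) (x : Euc p) :
    totalObj (regularize f ε R) g x = totalObj f g x + ε / (2 * R) * ‖x‖ ^ 2 := rfl

namespace IsConvexStronglyConvex

lemma gradX_regularize (h : IsConvexStronglyConvex f g Lx Lxy Ly Ltxy Lty ρxy ρyy μ)
    (ε R : ℝ) (x : Euc p) (y : Euc q) :
    gradX (regularize f ε R) x y = gradX f x y + (ε / R) • x := by
  have h1 : DifferentiableAt ℝ (fun z : Euc p × Euc q => f z.1 z.2) (x, y) :=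
    (h.contDiff_f.differentiable one_ne_zero) _
  have h2 : DifferentiableAt ℝ (fun x' => f x' y) x :=
    h1.comp x (f := fun x' => (x', y)) (by fun_prop)
  refine HasGradientAt.gradient ?_
  rw [hasGradientAt_iff_hasFDerivAt]
  refine (h2.hasGradientAt.hasFDerivAt.add
    ((hasStrictFDerivAt_norm_sq x).hasFDerivAt.const_mul (ε / (2 * R)))).congr_fderiv ?_
  ext v
  simp [gradX]
  ring

/-- The regularized problem belongs to the class, with `Lx` replaced by `Lx + ε / R`. -/
lemma regularize (h : IsConvexStronglyConvex f g Lx Lxy Ly Ltxy Lty ρxy ρyy μ)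
    (hε : 0 ≤ ε) (hR : 0 < R) :
    IsConvexStronglyConvex (regularize f ε R) g (Lx + ε / R) Lxy Ly Ltxy Lty ρxy ρyy μ where
  contDiff_f := h.contDiff_f.add (contDiff_const.mul (contDiff_fst.norm_sq ℝ))
  contDiff_g := h.contDiff_g
  differentiable_gradY_g := h.differentiable_gradY_g
  gradX_f_x x₁ x₂ y := by
    rw [h.gradX_regularize, h.gradX_regularize]
    have e : gradX f x₁ y + (ε / R) • x₁ - (gradX f x₂ y + (ε / R) • x₂)
        = (gradX f x₁ y - gradX f x₂ y) + (ε / R) • (x₁ - x₂) := by module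
    rw [e, add_mul]
    refine (norm_add_le _ _).trans (add_le_add (h.gradX_f_x x₁ x₂ y) ?_)
    rw [norm_smul, Real.norm_of_nonneg (by positivity)]
  gradX_f_y x y₁ y₂ := by
    rw [h.gradX_regularize, h.gradX_regularize, add_sub_add_right_eq_sub]
    exact h.gradX_f_y x y₁ y₂
  gradY_f_x x₁ x₂ y := by
    rw [gradY_regularize, gradY_regularize]
    exact h.gradY_f_x x₁ x₂ y
  gradY_f_y x y₁ y₂ := by
    rw [gradY_regularize, gradY_regularize]
    exact h.gradY_f_y x y₁ y₂
  gradY_g_x := h.gradY_g_x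
  gradY_g_y := h.gradY_g_y
  jacXY_g := h.jacXY_g
  hessYY_g := h.hessYY_g
  strongConvex_g := h.strongConvex_g
  convex_totalObj := by
    refine h.convex_totalObj.add (ConvexOn.smul (c := ε / (2 * R)) (by positivity) ?_)
    exact (convexOn_norm convex_univ).pow (fun _ _ => norm_nonneg _) 2

lemma strongConvexOn_regularize (h : IsConvexStronglyConvex f g Lx Lxy Ly Ltxy Lty ρxy ρyy μ) :
    StrongConvexOn univ (ε / R) (totalObj (_root_.regularize f ε R) g) := by
  rw [strongConvexOn_iff_convex]
  refine h.convex_totalObj.congr fun x _ => ?_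
  rw [totalObj_regularize]
  ring

lemma hyperGrad_regularize (h : IsConvexStronglyConvex f g Lx Lxy Ly Ltxy Lty ρxy ρyy μ)
    (ε R : ℝ) (x : Euc p) :
    hyperGrad (_root_.regularize f ε R) g x = hyperGrad f g x + (ε / R) • x := by
  simp only [hyperGrad, h.gradX_regularize, linearSol, gradY_regularize]
  abel

/-- The chosen minimizer of the regularized total objective is a minimizer. -/
lemma argminPt_regularize_le (h : IsConvexStronglyConvex f g Lx Lxy Ly Ltxy Lty ρxy ρyy μ)
    (hμ : 0 < μ) (hε : 0 < ε) (hR : 0 < R) (u : Euc p) :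
    totalObj (_root_.regularize f ε R) g (argminPt (totalObj (_root_.regularize f ε R) g))
      ≤ totalObj (_root_.regularize f ε R) g u := by
  have h' := h.regularize hε.le hR
  have hgrad := h'.hasGradientAt_totalObj hμ
  refine argminPt_le (exists_forall_le_of_quadratic_lower_bound ?_ (div_pos hε hR)
    (g := hyperGrad (_root_.regularize f ε R) g 0) fun u => ?_) u
  · exact continuous_iff_continuousAt.2 fun x => (hgrad x).differentiableAt.continuousAt
  · simpa using h.strongConvexOn_regularize.add_inner_gradient_le (hgrad 0) u

/-- Since x* minimizes Φ and x̃* minimizes Φ̃, the regularizer cannot be larger at x̃* than at x*.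
-/
lemma norm_argminPt_regularize_le (h : IsConvexStronglyConvex f g Lx Lxy Ly Ltxy Lty ρxy ρyy μ)
    (hμ : 0 < μ) (hε : 0 < ε) (hR : 0 < R) {xs : Euc p}
    (hxs : ∀ u, totalObj f g xs ≤ totalObj f g u) :
    ‖argminPt (totalObj (_root_.regularize f ε R) g)‖ ≤ ‖xs‖ := by
  have h1 := h.argminPt_regularize_le hμ hε hR xs
  rw [totalObj_regularize, totalObj_regularize] at h1
  have h2 := hxs (argminPt (totalObj (_root_.regularize f ε R) g))
  have h3 : ε / (2 * R) * ‖argminPt (totalObj (_root_.regularize f ε R) g)‖ ^ 2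
      ≤ ε / (2 * R) * ‖xs‖ ^ 2 := by linarith
  have h4 := le_of_mul_le_mul_left h3 (by positivity)
  exact le_of_sq_le_sq h4 (norm_nonneg _)

end IsConvexStronglyConvex

end Regularization

/-! ### Bookkeeping of bounds by powers of one large number -/

section PowBdd

/-- `a` is nonnegative and at most `W ^ n`. -/
def PowBdd (W : ℝ) (n : ℕ) (a : ℝ) : Prop := 0 ≤ a ∧ a ≤ W ^ n

namespace PowBdd

variable {W a b : ℝ} {n m : ℕ}

lemma of_le (hb : PowBdd W n b) (ha : 0 ≤ a) (hab : a ≤ b) : PowBdd W n a :=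
  ⟨ha, hab.trans hb.2⟩

lemma const (ha : 0 ≤ a) (haW : a ≤ W) : PowBdd W 1 a := ⟨ha, by simpa using haW⟩

lemma mono (ha : PowBdd W n a) (hW : 2 ≤ W) (hnm : n ≤ m) : PowBdd W m a :=
  ⟨ha.1, ha.2.trans (pow_le_pow_right₀ (by linarith) hnm)⟩

/-- A sum costs one extra power because 2 ≤ W. -/
lemma add (ha : PowBdd W n a) (hb : PowBdd W m b) (hW : 2 ≤ W) :
    PowBdd W (max n m + 1) (a + b) := by
  refine ⟨add_nonneg ha.1 hb.1, ?_⟩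
  have h1 := (ha.mono hW (le_max_left n m)).2
  have h2 := (hb.mono hW (le_max_right n m)).2
  have h3 : 0 ≤ W ^ max n m := by positivity
  rw [pow_succ]
  nlinarith

lemma mul (ha : PowBdd W n a) (hb : PowBdd W m b) : PowBdd W (n + m) (a * b) := by
  refine ⟨mul_nonneg ha.1 hb.1, ?_⟩
  rw [pow_add]
  exact mul_le_mul ha.2 hb.2 hb.1 (ha.1.trans ha.2)

lemma pow (ha : PowBdd W n a) (k : ℕ) : PowBdd W (n * k) (a ^ k) := by
  refine ⟨pow_nonneg ha.1 k, ?_⟩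
  rw [pow_mul]
  exact pow_le_pow_left₀ ha.1 ha.2 k

lemma sqrt (ha : PowBdd W n a) (hW : 2 ≤ W) : PowBdd W n (Real.sqrt a) := by
  refine ⟨Real.sqrt_nonneg a, Real.sqrt_le_iff.2 ⟨ha.1.trans ha.2, ha.2.trans ?_⟩⟩
  exact le_self_pow₀ (one_le_pow₀ (by linarith)) two_ne_zero

end PowBdd

end PowBdd

/-! ### Bounds for the radius and the smoothness parameter in terms of Δ -/

section Constants

variable {p q : ℕ} {f g : Euc p → Euc q → ℝ} {Lx Lxy Ly Ltxy Lty ρxy ρyy μ ε R ε' c : ℝ}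

/-- The scale `1 / μ² + (ρyy / μ³ + ρxy / μ²) Δ` of the smoothness constant of `Φ`. -/
noncomputable def smoothnessScale (ρxy ρyy μ Δ : ℝ) : ℝ :=
  1 / μ ^ 2 + (ρyy / μ ^ 3 + ρxy / μ ^ 2) * Δ

/-- As c dominates the constants and μ, missing powers of 1/μ are supplied by 1 ≤ c/μ. This and the
next two lemmas bring the parts of `smoothnessParam` to common powers of 1/μ. -/
lemma constant_part_le (hLx : 0 ≤ Lx) (hLxy : 0 ≤ Lxy) (hLy : 0 ≤ Ly) (hL : 0 ≤ Ltxy)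
    (hμ : 0 < μ) (hc : 1 + Lx + Lxy + Ly + Ltxy + μ ≤ c) :
    Lx + 2 * Lxy * Ltxy / μ + Ly * Ltxy ^ 2 / μ ^ 2 ≤ 4 * c ^ 3 / μ ^ 2 := by
  have hc0 : 0 ≤ c := by linarith
  rw [le_div_iff₀ (by positivity)]
  have e : (Lx + 2 * Lxy * Ltxy / μ + Ly * Ltxy ^ 2 / μ ^ 2) * μ ^ 2
      = Lx * μ ^ 2 + 2 * (Lxy * Ltxy * μ) + Ly * Ltxy ^ 2 := by
    field_simp
  rw [e]
  have h1 : Lx * μ ^ 2 ≤ c * c ^ 2 := by gcongr <;> linarith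
  have h2 : Lxy * Ltxy * μ ≤ c * c * c := by gcongr <;> linarith
  have h3 : Ly * Ltxy ^ 2 ≤ c * c ^ 2 := by gcongr <;> linarith
  linarith [h1, h2, h3]

lemma curvature_part_le (hLx : 0 ≤ Lx) (hLxy : 0 ≤ Lxy) (hLy : 0 ≤ Ly) (hL : 0 ≤ Ltxy)
    (hμ : 0 < μ) (hρ : 0 ≤ ρyy) (hρ' : 0 ≤ ρxy) (hc : 1 + Lx + Lxy + Ly + Ltxy + μ ≤ c) :
    (Ltxy * ρyy / μ ^ 2 + ρxy / μ) * (1 + Ltxy / μ)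
      ≤ c ^ 2 * (ρyy / μ ^ 3 + ρxy / μ ^ 2) := by
  have h1 : 1 + Ltxy / μ ≤ c / μ := by
    rw [le_div_iff₀ hμ, add_mul, div_mul_cancel₀ _ hμ.ne']; linarith
  have h2 : Ltxy * ρyy / μ ^ 2 + ρxy / μ ≤ c * (ρyy / μ ^ 2 + ρxy / μ) := by
    have a1 : Ltxy * (ρyy / μ ^ 2) ≤ c * (ρyy / μ ^ 2) :=
      mul_le_mul_of_nonneg_right (by linarith) (by positivity)
    have a2 : 1 * (ρxy / μ) ≤ c * (ρxy / μ) :=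
      mul_le_mul_of_nonneg_right (by linarith) (by positivity)
    rw [mul_div_assoc]
    linarith
  have hc0 : 0 ≤ c := by linarith
  refine (mul_le_mul h2 h1 (by positivity) (by positivity)).trans_eq ?_
  field_simp

lemma gradient_part_le (hLx : 0 ≤ Lx) (hLxy : 0 ≤ Lxy) (hLy : 0 ≤ Ly) (hL : 0 ≤ Ltxy)
    (hμ : 0 < μ) (hc : 1 + Lx + Lxy + Ly + Ltxy + μ ≤ c) :
    Lxy + Ly * Ltxy / μ ≤ c ^ 2 / μ := by
  rw [le_div_iff₀ hμ, add_mul, div_mul_cancel₀ _ hμ.ne']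
  have h1 : Lxy * μ ≤ Lxy * c := by gcongr; linarith
  have h2 : Ly * Ltxy ≤ Ly * c := by gcongr; linarith
  have h3 : (Lxy + Ly) * c ≤ c * c := by gcongr <;> linarith
  linarith

lemma deltaCSC_terms_nonneg (hμ : 0 < μ) (xs : Euc p) :
    0 ≤ ‖gradY f xs (innerSol g xs)‖ ∧ 0 ≤ ‖xs‖ / μ ∧
      0 ≤ (‖xs‖ + 1) * Real.sqrt (totalObj f g 0 - totalObj f g xs) / Real.sqrt ε / μ ∧
      ‖gradY f xs (innerSol g xs)‖ + ‖xs‖ / μ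
        + (‖xs‖ + 1) * Real.sqrt (totalObj f g 0 - totalObj f g xs) / Real.sqrt ε / μ
        = deltaCSC f g μ ε xs :=
  ⟨by positivity, by positivity, by positivity, by rw [deltaCSC, div_div]⟩

/-- The term ‖x̃*‖² cancels against the regularizer in Φ̃(0) - Φ̃(x̃*), leaving a multiple of Φ(0) -
Φ(x̃*) ≤ Φ(0) - Φ(x*). The hypothesis on √R covers both R = B² and R = B, and explains the factor
‖x*‖ + 1 in Δ. -/
lemma iterateRadius_regularize_le (hε : 0 < ε) (hR : 0 < R) {xs : Euc p}
    (hxs : ∀ u, totalObj f g xs ≤ totalObj f g u)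
    (hRB : Real.sqrt R ≤ ‖xs‖ + 1) (hε' : ε' / (ε / R) ≤ ‖xs‖ ^ 2) :
    iterateRadius (regularize f ε R) g (ε / R) ε'
        (argminPt (totalObj (regularize f ε R) g))
      ≤ 2 * ((‖xs‖ + 1) * Real.sqrt (totalObj f g 0 - totalObj f g xs) / Real.sqrt ε) + ‖xs‖ := by
  have hxt := hxs (argminPt (totalObj (regularize f ε R) g))
  have h0 := hxs 0
  rw [iterateRadius]
  set xt := argminPt (totalObj (regularize f ε R) g)
  set Ψ := totalObj f g 0 - totalObj f g xs with hΨ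
  have hΨ0 : 0 ≤ Ψ := by linarith
  refine Real.sqrt_le_iff.2 ⟨by positivity, ?_⟩
  have e : 2 / (ε / R) * (totalObj (regularize f ε R) g 0
      - totalObj (regularize f ε R) g xt) + ‖xt‖ ^ 2
      = 2 / (ε / R) * (totalObj f g 0 - totalObj f g xt) := by
    rw [totalObj_regularize, totalObj_regularize, norm_zero]
    field_simp
    ring
  rw [e]
  have h1 : 2 / (ε / R) * (totalObj f g 0 - totalObj f g xt) ≤ 2 / (ε / R) * Ψ :=
    mul_le_mul_of_nonneg_left (by linarith) (by positivity)
  have h2 : R ≤ (‖xs‖ + 1) ^ 2 := (Real.sqrt_le_iff.1 hRB).2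
  have h3 : 2 / (ε / R) * Ψ ≤ 2 * ((‖xs‖ + 1) * Real.sqrt Ψ / Real.sqrt ε) ^ 2 := by
    rw [div_pow, mul_pow, Real.sq_sqrt hΨ0, Real.sq_sqrt hε.le]
    have e2 : 2 / (ε / R) * Ψ = 2 * (R * Ψ / ε) := by field_simp
    rw [e2]
    gcongr
  set s := (‖xs‖ + 1) * Real.sqrt Ψ / Real.sqrt ε with hs
  have hs0 : 0 ≤ s := by positivity
  have := norm_nonneg xs
  nlinarith [mul_nonneg hs0 this, sq_nonneg s]

namespace IsConvexStronglyConvex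

/-- The initial gap, in terms of the smoothness scale. -/
lemma initial_gap_le (h : IsConvexStronglyConvex f g Lx Lxy Ly Ltxy Lty ρxy ρyy μ)
    (hμ : 0 < μ) (hLx : 0 ≤ Lx) (hLxy : 0 ≤ Lxy) (hLy : 0 ≤ Ly) (hL : 0 ≤ Ltxy) (hρ : 0 ≤ ρyy)
    (hρ' : 0 ≤ ρxy) (hc : 1 + Lx + Lxy + Ly + Ltxy + μ ≤ c) {xs : Euc p}
    (hxs : ∀ u, totalObj f g xs ≤ totalObj f g u) :
    totalObj f g 0 - totalObj f g xs
      ≤ 9 * c ^ 4 * smoothnessScale ρxy ρyy μ (deltaCSC f g μ ε xs) / 2 * ‖xs‖ ^ 2 := by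
  have hgrad := h.hasGradientAt_totalObj hμ
  have h1 := le_add_inner_gradient_add_sq hgrad
    (h.norm_hyperGrad_sub_le hμ hLxy hLy hL hρ hρ' xs) 0
  rw [(hgrad xs).eq_zero_of_forall_le hxs, inner_zero_left, zero_sub, norm_neg] at h1
  obtain ⟨d1, d2, d3, d4⟩ := deltaCSC_terms_nonneg (f := f) (g := g) (ε := ε) hμ xs
  set Δ := deltaCSC f g μ ε xs
  have hc1 : 1 ≤ c := by linarith
  have a1 := constant_part_le hLx hLxy hLy hL hμ hc
  have a2 := curvature_part_le hLx hLxy hLy hL hμ hρ hρ' hc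
  set P := ρyy / μ ^ 3 + ρxy / μ ^ 2 with hP
  have hP0 : 0 ≤ P := by positivity
  have a3 := mul_le_mul a2 (show ‖gradY f xs (innerSol g xs)‖ ≤ Δ by linarith) d1 (by positivity)
  have hΔ : 0 ≤ P * Δ := mul_nonneg hP0 (by linarith)
  have a4 : 4 * c ^ 3 / μ ^ 2 + c ^ 2 * P * Δ ≤ 9 * c ^ 4 * smoothnessScale ρxy ρyy μ Δ := by
    rw [smoothnessScale, ← hP]
    have b1 : c ^ 3 ≤ c ^ 4 := pow_le_pow_right₀ hc1 (by norm_num)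
    have b2 : c ^ 2 ≤ c ^ 4 := pow_le_pow_right₀ hc1 (by norm_num)
    have b3 := mul_le_mul_of_nonneg_right b1 (show 0 ≤ 1 / μ ^ 2 by positivity)
    have b4 := mul_le_mul_of_nonneg_right b2 hΔ
    have b5 : 0 ≤ c ^ 4 * (1 / μ ^ 2) := by positivity
    have b6 : 0 ≤ c ^ 4 * (P * Δ) := by positivity
    have e : 4 * c ^ 3 / μ ^ 2 = 4 * (c ^ 3 * (1 / μ ^ 2)) := by ring
    rw [e]
    linarith
  have h2 := mul_le_mul_of_nonneg_right ((add_le_add a1 a3).trans a4) (sq_nonneg ‖xs‖)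
  linarith

lemma norm_argminPt_sub_le (h : IsConvexStronglyConvex f g Lx Lxy Ly Ltxy Lty ρxy ρyy μ)
    (hμ : 0 < μ) (hε : 0 < ε) (hR : 0 < R) {xs : Euc p}
    (hxs : ∀ u, totalObj f g xs ≤ totalObj f g u) :
    ‖argminPt (totalObj (_root_.regularize f ε R) g) - xs‖ ≤ 2 * ‖xs‖ := by
  have h1 := h.norm_argminPt_regularize_le hμ hε hR hxs
  have h2 := norm_sub_le (argminPt (totalObj (_root_.regularize f ε R) g)) xs
  linarith

/-- The summand ‖x*‖/μ of Δ pays for moving the base point from x* to x̃*. -/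
lemma norm_gradY_argminPt_le (h : IsConvexStronglyConvex f g Lx Lxy Ly Ltxy Lty ρxy ρyy μ)
    (hμ : 0 < μ) (hLx : 0 ≤ Lx) (hLxy : 0 ≤ Lxy) (hLy : 0 ≤ Ly) (hL : 0 ≤ Ltxy)
    (hε : 0 < ε) (hR : 0 < R) (hc : 1 + Lx + Lxy + Ly + Ltxy + μ ≤ c) {xs : Euc p}
    (hxs : ∀ u, totalObj f g xs ≤ totalObj f g u) :
    ‖gradY f (argminPt (totalObj (_root_.regularize f ε R) g))
        (innerSol g (argminPt (totalObj (_root_.regularize f ε R) g)))‖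
      ≤ 2 * c ^ 2 * deltaCSC f g μ ε xs := by
  set xt := argminPt (totalObj (_root_.regularize f ε R) g)
  obtain ⟨d1, d2, d3, d4⟩ := deltaCSC_terms_nonneg (f := f) (g := g) (ε := ε) hμ xs
  have h1 := h.norm_gradY_innerSol_le hμ hLy xt xs
  have h2 := h.norm_argminPt_sub_le hμ hε hR hxs
  have h3 := gradient_part_le hLx hLxy hLy hL hμ hc
  have h4 := mul_le_mul h3 h2 (norm_nonneg _) (by positivity)
  have hc1 : 1 ≤ c ^ 2 := one_le_pow₀ (by linarith)
  have e : c ^ 2 / μ * (2 * ‖xs‖) = 2 * (c ^ 2 * (‖xs‖ / μ)) := by ring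
  rw [e] at h4
  have h5 := mul_nonneg (show 0 ≤ 2 * c ^ 2 - 1 by linarith) d1
  have h6 := mul_nonneg (show 0 ≤ 2 * c ^ 2 by linarith) d3
  rw [← d4]
  linarith

/-- The smoothness parameter of the regularized problem, in terms of the smoothness scale. -/
lemma regSmoothness_le (h : IsConvexStronglyConvex f g Lx Lxy Ly Ltxy Lty ρxy ρyy μ)
    (hμ : 0 < μ) (hLx : 0 ≤ Lx) (hLxy : 0 ≤ Lxy) (hLy : 0 ≤ Ly) (hL : 0 ≤ Ltxy) (hρ : 0 ≤ ρyy)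
    (hρ' : 0 ≤ ρxy) (hε : 0 < ε) (hR : 0 < R) (hc : 1 + Lx + Lxy + Ly + Ltxy + μ ≤ c) {xs : Euc p}
    (hxs : ∀ u, totalObj f g xs ≤ totalObj f g u)
    (hRB : Real.sqrt R ≤ ‖xs‖ + 1) (hε' : ε' / (ε / R) ≤ ‖xs‖ ^ 2) :
    regSmoothness f g Lx Lxy Ly Ltxy ρxy ρyy μ ε R ε'
      ≤ ε / R + 9 * c ^ 4 * smoothnessScale ρxy ρyy μ (deltaCSC f g μ ε xs) := by
  have h1 := h.norm_gradY_argminPt_le hμ hLx hLxy hLy hL hε hR hc hxs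
  have h2 := iterateRadius_regularize_le hε hR hxs hRB hε'
  rw [iterateRadius] at h2
  rw [regSmoothness, smoothnessParam, gradY_regularize]
  obtain ⟨d1, d2, d3, d4⟩ := deltaCSC_terms_nonneg (f := f) (g := g) (ε := ε) hμ xs
  set Δ := deltaCSC f g μ ε xs
  set xt := argminPt (totalObj (_root_.regularize f ε R) g)
  have hc1 : 1 ≤ c := by linarith
  have a1 := constant_part_le hLx hLxy hLy hL hμ hc
  have a2 := curvature_part_le hLx hLxy hLy hL hμ hρ hρ' hc
  have a3 := gradient_part_le hLx hLxy hLy hL hμ hc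
  set P := ρyy / μ ^ 3 + ρxy / μ ^ 2 with hP
  have hP0 : 0 ≤ P := by positivity
  have b1 := mul_le_mul a2 h1 (norm_nonneg _) (by positivity)
  have b2 := mul_le_mul (mul_le_mul a2 a3 (by positivity) (by positivity)) h2
    (Real.sqrt_nonneg _) (by positivity)
  set s := (‖xs‖ + 1) * Real.sqrt (totalObj f g 0 - totalObj f g xs) / Real.sqrt ε
  -- The 1/μ from the Lipschitz constant of x ↦ ∇_y f (x, y*(x)) meets the radius, and s/μ, ‖xs‖/μ
  -- are summands of Δ. In total PΔ gets the coefficient 2 + 3 · 2 = 8 ≤ 9.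
  have b3 : c ^ 2 * P * (c ^ 2 / μ) * (2 * s + ‖xs‖) = c ^ 4 * P * (2 * (s / μ) + ‖xs‖ / μ) := by
    ring
  rw [b3] at b2
  have b4 : c ^ 4 * P * (2 * (s / μ) + ‖xs‖ / μ) ≤ c ^ 4 * P * (2 * Δ) :=
    mul_le_mul_of_nonneg_left (by linarith) (by positivity)
  rw [smoothnessScale, ← hP]
  have c1 : c ^ 3 ≤ c ^ 4 := pow_le_pow_right₀ hc1 (by norm_num)
  have c2 := mul_le_mul_of_nonneg_right c1 (show 0 ≤ 1 / μ ^ 2 by positivity)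
  have c3 : 0 ≤ c ^ 4 * (1 / μ ^ 2) := by positivity
  have c4 : 0 ≤ c ^ 4 * (P * Δ) := mul_nonneg (by positivity) (mul_nonneg hP0 (by linarith))
  have e : 4 * c ^ 3 / μ ^ 2 = 4 * (c ^ 3 * (1 / μ ^ 2)) := by ring
  rw [e] at a1
  linarith

end IsConvexStronglyConvex

end Constants

/-! ### Iteration numbers that reach the accuracy -/

section Accuracy

variable {p q : ℕ} {f g : Euc p → Euc q → ℝ} {Lx Lxy Ly Ltxy Lty ρxy ρyy μ ε R ε' c W L : ℝ}

lemma exp_neg_le_inv_pow {W t : ℝ} (hW : 0 < W) {n : ℕ} (h : n * Real.log W ≤ t) :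
    Real.exp (-t) ≤ (W ^ n)⁻¹ := by
  rw [Real.exp_neg]
  refine inv_anti₀ (by positivity) ?_
  rw [← Real.exp_log (pow_pos hW n), Real.log_pow]
  exact Real.exp_le_exp.2 h

namespace IsConvexStronglyConvex

/-- AccBiO on the regularized problem reaches the accuracy `ε'` when the numbers of iterations
exceed a multiple of the square roots of the condition numbers times a logarithm. -/
theorem accBiO_regularize_gap_le (h : IsConvexStronglyConvex f g Lx Lxy Ly Ltxy Lty ρxy ρyy μ)
    (hμ : 0 < μ) (hLty : μ ≤ Lty) (hLx : 0 ≤ Lx) (hLxy : 0 ≤ Lxy) (hLy : 0 ≤ Ly) (hL : 0 ≤ Ltxy)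
    (hρ : 0 ≤ ρyy) (hρ' : 0 ≤ ρxy) (hε : 0 < ε) (hR : 0 < R) (hε'0 : 0 < ε')
    (hc : 1 + Lx + Lxy + Ly + Ltxy + μ ≤ c) {xs : Euc p}
    (hxs : ∀ u, totalObj f g xs ≤ totalObj f g u)
    (hRB : Real.sqrt R ≤ ‖xs‖ + 1) (hε' : ε' / (ε / R) ≤ ‖xs‖ ^ 2)
    (hLdef : L = regSmoothness f g Lx Lxy Ly Ltxy ρxy ρyy μ ε R ε')
    (hinv : ε'⁻¹ ≤ 2 * ε⁻¹ + (4 * L + 8 * (ε / R)) * ε⁻¹ ^ 2)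
    (hW : 100 ≤ W) (hcW : c ≤ W) (hεW : ε ≤ W) (hεW' : ε⁻¹ ≤ W) (hRW : R⁻¹ ≤ W ^ 2)
    (hμW : μ⁻¹ ≤ W) (hLtyW : Lty ≤ W) (hρW : ρyy ≤ W) (hρW' : ρxy ≤ W)
    (hΔW : deltaCSC f g μ ε xs ≤ W) (hysW : ‖innerSol g xs‖ ≤ W) {K M N : ℕ}
    (hK : totalObj f g 0 - totalObj f g xs ≤ ε' / 2 ∨
      400 * Real.sqrt (L / (ε / R)) * Real.log W ≤ K)
    (hM : 400 * Real.sqrt (Lty / μ) * Real.log W ≤ M)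
    (hN : 400 * Real.sqrt (Lty / μ) * Real.log W ≤ N) :
    ‖(accBiO (_root_.regularize f ε R) g Lty μ L (ε / R) M N K).z
        - argminPt (totalObj (_root_.regularize f ε R) g)‖
      ≤ iterateRadius (_root_.regularize f ε R) g (ε / R) ε'
          (argminPt (totalObj (_root_.regularize f ε R) g)) ∧
    totalObj (_root_.regularize f ε R) g
        (accBiO (_root_.regularize f ε R) g Lty μ L (ε / R) M N K).z
      - totalObj (_root_.regularize f ε R) g (argminPt (totalObj (_root_.regularize f ε R) g))
      ≤ ε' := by
  have h' := h.regularize hε.le hR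
  have hW2 : 2 ≤ W := by linarith
  have hW0 : 0 < W := by linarith
  have hμx : 0 < ε / R := div_pos hε hR
  have hLle := h.regSmoothness_le hμ hLx hLxy hLy hL hρ hρ' hε hR hc hxs hRB hε'
  rw [← hLdef] at hLle
  have hDle := iterateRadius_regularize_le (f := f) (g := g) hε hR hxs hRB hε'
  have hgy := h.norm_gradY_argminPt_le hμ hLx hLxy hLy hL hε hR hc hxs
  have hxtle := h.norm_argminPt_sub_le hμ hε hR hxs
  have hyt := h.norm_innerSol_le hμ (argminPt (totalObj (_root_.regularize f ε R) g)) xs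
  have hmin := h.argminPt_regularize_le hμ hε hR
  obtain ⟨d1, d2, d3, d4⟩ := deltaCSC_terms_nonneg (f := f) (g := g) (ε := ε) hμ xs
  set xt := argminPt (totalObj (_root_.regularize f ε R) g) with hxt
  set Δ := deltaCSC f g μ ε xs
  set D := iterateRadius (_root_.regularize f ε R) g (ε / R) ε' xt with hDdef
  set Ψ := totalObj f g 0 - totalObj f g xs with hΨ
  have hΨ0 : 0 ≤ Ψ := by have := hxs 0; linarith
  have hD0 : 0 ≤ D := Real.sqrt_nonneg _
  have hμxL : ε / R ≤ L :=
    hLdef ▸ div_le_regSmoothness hμ hLx hLxy hLy hL hρ hρ' f g ε R ε'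
  have hL0 : 0 < L := hμx.trans_le hμxL
  -- bounds by powers of `W`
  have wc : PowBdd W 1 c := .const (by linarith) hcW
  have wε : PowBdd W 1 ε := .const hε.le hεW
  have wεi : PowBdd W 1 ε⁻¹ := .const (by positivity) hεW'
  have wμ : PowBdd W 1 μ := .const hμ.le (by linarith)
  have wμi : PowBdd W 1 μ⁻¹ := .const (by positivity) hμW
  have wLty : PowBdd W 1 Lty := .const (by linarith) hLtyW
  have wρ : PowBdd W 1 ρyy := .const hρ hρW
  have wρ' : PowBdd W 1 ρxy := .const hρ' hρW'
  have wLxy : PowBdd W 1 Lxy := .const hLxy (by linarith)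
  have wLy : PowBdd W 1 Ly := .const hLy (by linarith)
  have wLt : PowBdd W 1 Ltxy := .const hL (by linarith)
  have wΔ : PowBdd W 1 Δ := .const (by linarith) hΔW
  have wys : PowBdd W 1 ‖innerSol g xs‖ := .const (norm_nonneg _) hysW
  have wRi : PowBdd W 2 R⁻¹ := ⟨by positivity, hRW⟩
  have wn : ∀ a : ℝ, 0 ≤ a → a ≤ 100 → PowBdd W 1 a := fun a h0 h1 => .const h0 (h1.trans hW)
  -- Neither ‖x*‖ nor the initial gap is bounded by a hypothesis; both are recovered from Δ, through
  -- ‖x*‖ ≤ μΔ and Ψ ≤ ε s² with s ≤ μΔ. The latter uses ‖x*‖ + 1 ≥ 1.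
  have wB : PowBdd W 2 ‖xs‖ := (wμ.mul wΔ).of_le (norm_nonneg _) (by
    rw [← div_le_iff₀' hμ]; linarith)
  set s := (‖xs‖ + 1) * Real.sqrt Ψ / Real.sqrt ε with hs
  have hs0 : 0 ≤ s := by positivity
  have ws : PowBdd W 2 s := (wμ.mul wΔ).of_le hs0 (by rw [← div_le_iff₀' hμ]; linarith)
  have wΨ : PowBdd W 5 Ψ := (wε.mul (ws.pow 2)).of_le hΨ0 (by
    rw [hs, div_pow, mul_pow, Real.sq_sqrt hΨ0, Real.sq_sqrt hε.le]
    have h1 : 1 ≤ (‖xs‖ + 1) ^ 2 := one_le_pow₀ (by linarith [norm_nonneg xs])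
    have e : ε * ((‖xs‖ + 1) ^ 2 * Ψ / ε) = (‖xs‖ + 1) ^ 2 * Ψ := by field_simp
    rw [e]
    exact le_mul_of_one_le_left hΨ0 h1)
  have wD : PowBdd W 4 D := (((wn 2 (by norm_num) (by norm_num)).mul ws).add wB hW2).of_le hD0 hDle
  have wR : PowBdd W 6 R := ((wB.add (wn 1 (by norm_num) (by norm_num)) hW2).pow 2).of_le hR.le
    (Real.sqrt_le_iff.1 hRB).2
  have wμx : PowBdd W 3 (ε / R) := wε.mul wRi
  have wμxi : PowBdd W 7 (ε / R)⁻¹ := by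
    rw [inv_div]; exact wR.mul wεi
  have wA : PowBdd W 7 (smoothnessScale ρxy ρyy μ Δ) := by
    have := (wμi.pow 2).add (((wρ.mul (wμi.pow 3)).add (wρ'.mul (wμi.pow 2)) hW2).mul wΔ) hW2
    refine (this.mono hW2 (by norm_num)).of_le ?_ (le_of_eq ?_)
    · rw [smoothnessScale]
      have : 0 ≤ Δ := by linarith
      positivity
    · rw [smoothnessScale]
      field_simp
  have wL : PowBdd W 13 L := ((wμx.add
    (((wn 9 (by norm_num) (by norm_num)).mul (wc.pow 4)).mul wA) hW2).mono hW2
      (by norm_num)).of_le hL0.le hLle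
  have wLi : PowBdd W 7 L⁻¹ := wμxi.of_le (by positivity) (inv_anti₀ hμx hμxL)
  have wε'i : PowBdd W 18 ε'⁻¹ := ((((wn 2 (by norm_num) (by norm_num)).mul wεi).add
    ((((wn 4 (by norm_num) (by norm_num)).mul wL).add
      ((wn 8 (by norm_num) (by norm_num)).mul wμx) hW2).mul (wεi.pow 2)) hW2).mono hW2
      (by norm_num)).of_le (by positivity) hinv
  set rx := Real.sqrt (L / (ε / R)) with hrx
  set ry := Real.sqrt (Lty / μ) with hry
  have wrx : PowBdd W 20 rx := (wL.mul wμxi).sqrt hW2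
  have wry : PowBdd W 2 ry := (wLty.mul wμi).sqrt hW2
  have hrx1 : 1 ≤ rx := by
    rw [hrx, Real.one_le_sqrt, one_le_div hμx]; exact hμxL
  have hry1 : 1 ≤ ry := by
    rw [hry, Real.one_le_sqrt, one_le_div hμ]; exact hLty
  have hlogW : 0 ≤ Real.log W := Real.log_nonneg (by linarith)
  have wgy : PowBdd W 4 ‖gradY f xt (innerSol g xt)‖ :=
    (((wn 2 (by norm_num) (by norm_num)).mul (wc.pow 2)).mul wΔ).of_le (norm_nonneg _) hgy
  have wyt : PowBdd W 6 ‖innerSol g xt‖ :=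
    (wys.add ((wLt.mul wμi).mul ((wn 2 (by norm_num) (by norm_num)).mul wB)) hW2).of_le
      (norm_nonneg _) (hyt.trans (add_le_add le_rfl
        (mul_le_mul_of_nonneg_left hxtle (by positivity))))
  have wg : PowBdd W 4 (Lxy + Ly * Ltxy / μ) := wLxy.add ((wLy.mul wLt).mul wμi) hW2
  set β := ‖gradY f xt (innerSol g xt)‖ + (Lxy + Ly * Ltxy / μ) * (3 * D) with hβ
  set Y := ‖innerSol g xt‖ + Ltxy / μ * (3 * D) with hY
  have w3D := (wn 3 (by norm_num) (by norm_num)).mul wD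
  have wβ : PowBdd W 10 β := wgy.add (wg.mul w3D) hW2
  have wY : PowBdd W 8 Y := wyt.add ((wLt.mul wμi).mul w3D) hW2
  have wP : PowBdd W 5 (Ltxy * ρyy / μ ^ 2 + ρxy / μ) := by
    have := ((wLt.mul wρ).mul (wμi.pow 2)).add (wρ'.mul wμi) hW2
    rw [inv_pow] at this
    exact this
  have wE1 : PowBdd W 27 ((Lxy + Ltxy * Ly / μ + (Ltxy * ρyy / μ ^ 2 + ρxy / μ) * β)
      * (2 * ry * Y)) :=
    ((((wLxy.add ((wLt.mul wLy).mul wμi) hW2).add (wP.mul wβ) hW2).mul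
      (((wn 2 (by norm_num) (by norm_num)).mul wry).mul wY))).mono hW2 (by norm_num)
  have wE2 : PowBdd W 18 (Ltxy * (18 * ry * ((β + Ly * (2 * ry * Y)) / μ))) :=
    (wLt.mul (((wn 18 (by norm_num) (by norm_num)).mul wry).mul ((wβ.add (wLy.mul
      (((wn 2 (by norm_num) (by norm_num)).mul wry).mul wY)) hW2).mul wμi))).mono hW2 (by norm_num)
  have wδ : PowBdd W 50 (2 * (7 * D + L⁻¹) * rx * ε'⁻¹) :=
    ((((wn 2 (by norm_num) (by norm_num)).mul (((wn 7 (by norm_num) (by norm_num)).mul wD).add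
      wLi hW2)).mul wrx).mul wε'i).mono hW2 (by norm_num)
  -- The factor 400 is generous: the error prefactors are at most W^50, so the decay W^(-100) leaves
  -- δ = W^(-50), which in turn beats the W^50 needed for the accuracy condition.
  have hexp : ∀ n : ℕ, 400 * ry * Real.log W ≤ n → Real.exp (-(n / (2 * ry))) ≤ (W ^ 100)⁻¹ := by
    intro n hn
    refine exp_neg_le_inv_pow hW0 ?_
    rw [le_div_iff₀ (by positivity)]
    push_cast
    have : 0 ≤ ry * Real.log W := by positivity
    linarith
  have hδ1 : (W ^ 50)⁻¹ ≤ 1 := inv_le_one_of_one_le₀ (one_le_pow₀ (by linarith))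
  have hδ0 : 0 < (W ^ 50)⁻¹ := by positivity
  have hmain := h'.accBiO_gap_le hμ hLty hLxy hLy hL hρ hρ' hμx (by linarith) hε'0
    h.strongConvexOn_regularize hmin (L := L) (D := D) (r := ry) (β := β) (Y := Y)
    (δ := (W ^ 50)⁻¹) hLdef.symm hDdef.symm hry.symm hδ0.le
    (by
      rw [← hrx, div_div, le_div_iff₀ (by positivity)]
      have h1 : 7 * D + (W ^ 50)⁻¹ / L ≤ 7 * D + L⁻¹ := by
        rw [div_eq_mul_inv]
        exact add_le_add le_rfl (mul_le_of_le_one_left (by positivity) hδ1)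
      have h2 := mul_le_mul_of_nonneg_left wδ.2 hδ0.le
      rw [inv_mul_cancel₀ (by positivity)] at h2
      have h3 : (W ^ 50)⁻¹ * (2 * (7 * D + L⁻¹) * rx * ε'⁻¹) * ε' ≤ 1 * ε' :=
        mul_le_mul_of_nonneg_right h2 hε'0.le
      have h4 : (W ^ 50)⁻¹ * (2 * (7 * D + L⁻¹) * rx * ε'⁻¹) * ε'
          = (W ^ 50)⁻¹ * (7 * D + L⁻¹) * (2 * rx) := by
        field_simp
      rw [h4, one_mul] at h3
      refine le_trans ?_ h3
      gcongr)
    (by rw [gradY_regularize]) le_rfl M N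
    (by
      have h1 := mul_le_mul_of_nonneg_left (hexp N hN) wE1.1
      have h2 := mul_le_mul_of_nonneg_left (hexp M hM) wE2.1
      have h3 := (wE1.add wE2 hW2).mono hW2 (show _ ≤ 50 by norm_num)
      have h4 := mul_le_mul_of_nonneg_right h3.2 (show 0 ≤ (W ^ 100)⁻¹ by positivity)
      have h5 : W ^ 50 * (W ^ 100)⁻¹ = (W ^ 50)⁻¹ := by
        rw [show (100 : ℕ) = 50 + 50 by norm_num, pow_add]
        field_simp
      rw [h5] at h4
      refine le_trans (le_of_eq ?_) ((add_le_add h1 h2).trans ((le_of_eq ?_).trans h4))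
      · ring
      · ring) K
  refine ⟨hmain.1, hmain.2.trans ?_⟩
  rw [← hrx]
  set E0 := totalObj (_root_.regularize f ε R) g 0 - totalObj (_root_.regularize f ε R) g xt
    + ε / R / 2 * ‖xt‖ ^ 2 with hE0
  have hE0Ψ : E0 ≤ Ψ := by
    have h1 := hxs xt
    rw [hE0, totalObj_regularize, totalObj_regularize, norm_zero]
    have e : ε / (2 * R) * ‖xt‖ ^ 2 = ε / R / 2 * ‖xt‖ ^ 2 := by
      congr 1; field_simp
    rw [e]
    linarith
  have hE00 : 0 ≤ E0 := by
    have := hmin 0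
    have : 0 ≤ ε / R / 2 * ‖xt‖ ^ 2 := by positivity
    linarith
  have hα : 0 ≤ 1 - 1 / rx := by
    rw [sub_nonneg, div_le_one (by linarith)]; exact hrx1
  have hα1 : 1 - 1 / rx ≤ 1 := by
    have : 0 ≤ 1 / rx := by positivity
    linarith
  -- If the initial gap is already small, contraction factors at most 1 are enough for every K;
  -- otherwise K is large and the factor is at most W^(-100).
  rcases hK with hK | hK
  · have := mul_le_of_le_one_left hE00 (pow_le_one₀ hα hα1 (n := K))
    linarith
  · have h1 : (1 - 1 / rx) ^ K ≤ (W ^ 100)⁻¹ := by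
      have h3 : 1 - 1 / rx ≤ Real.exp (-(1 / rx)) := by
        have := Real.add_one_le_exp (-(1 / rx))
        linarith
      refine (pow_le_pow_left₀ hα h3 K).trans ?_
      rw [← Real.exp_nat_mul, mul_neg, mul_one_div]
      refine exp_neg_le_inv_pow hW0 ?_
      rw [le_div_iff₀ (by positivity)]
      push_cast
      have : 0 ≤ rx * Real.log W := by positivity
      linarith
    have h2 : PowBdd W 100 (2 * (Ψ * ε'⁻¹)) :=
      ((wn 2 (by norm_num) (by norm_num)).mul (wΨ.mul wε'i)).mono hW2 (by norm_num)
    have h3 : (1 - 1 / rx) ^ K * E0 ≤ (W ^ 100)⁻¹ * Ψ :=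
      mul_le_mul h1 hE0Ψ hE00 (by positivity)
    have h4 := mul_le_mul_of_nonneg_left h2.2 (show 0 ≤ (W ^ 100)⁻¹ by positivity)
    rw [inv_mul_cancel₀ (by positivity)] at h4
    have h5 := mul_le_mul_of_nonneg_right h4 hε'0.le
    have h6 : (W ^ 100)⁻¹ * (2 * (Ψ * ε'⁻¹)) * ε' = 2 * ((W ^ 100)⁻¹ * Ψ) := by
      field_simp
    rw [h6] at h5
    linarith

end IsConvexStronglyConvex

end Accuracy

/-! ### Oracle complexity and the fixed-point equation -/

section Complexity

variable {p q : ℕ} {f g : Euc p → Euc q → ℝ} {Lx Lxy Ly Ltxy Lty ρxy ρyy μ ε R ε' c L τ : ℝ}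

/-- The constant in the complexity bounds. -/
noncomputable def complexityConst (c τ : ℝ) : ℝ :=
  403 ^ 2 * (τ + 1) * (1 + Real.log (100 * c) / Real.log 2) ^ 2 * Real.sqrt (17 * (9 * c ^ 4))

lemma complexityConst_pos (hc : 1 ≤ c) (hτ : 0 < τ) : 0 < complexityConst c τ := by
  have h1 : 0 ≤ Real.log (100 * c) := Real.log_nonneg (by linarith)
  have h2 : 0 < Real.log 2 := Real.log_pos (by norm_num)
  unfold complexityConst
  positivity

/-- As r and l are at least 1, rounding up and the two extra gradients are absorbed: 400 + 1 + 2 =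
403 for each of the two factors. -/
lemma cost_le_of_ceil (hτ : 0 ≤ τ) (f g : Euc p → Euc q → ℝ) (Lty μ L μx : ℝ) {rx ry l : ℝ}
    (hrx : 1 ≤ rx) (hry : 1 ≤ ry) (hl : 1 ≤ l) :
    (accBiO f g Lty μ L μx ⌈400 * ry * l⌉₊ ⌈400 * ry * l⌉₊ ⌈400 * rx * l⌉₊).count.cost τ
      ≤ 403 ^ 2 * (τ + 1) * (rx * ry) * l ^ 2 := by
  have h1 : 1 ≤ rx * l := one_le_mul_of_one_le_of_one_le hrx hl
  have h2 : 1 ≤ ry * l := one_le_mul_of_one_le_of_one_le hry hl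
  have hK := (Nat.ceil_lt_add_one (show 0 ≤ 400 * rx * l by nlinarith)).le
  have hM := (Nat.ceil_lt_add_one (show 0 ≤ 400 * ry * l by nlinarith)).le
  refine (cost_accBiO_le hτ f g Lty μ L μx _ _ _).trans ?_
  set K : ℝ := (⌈400 * rx * l⌉₊ : ℝ)
  set M : ℝ := (⌈400 * ry * l⌉₊ : ℝ)
  have hK' : K ≤ 403 * (rx * l) := by linarith
  have h3 : τ * (1 + M) + (M + 2) ≤ 403 * (τ + 1) * (ry * l) := by
    have := mul_le_mul_of_nonneg_left (show 1 + M ≤ 403 * (ry * l) by linarith) hτ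
    linarith
  have hM0 : 0 ≤ M := Nat.cast_nonneg _
  refine (mul_le_mul hK' h3 (by positivity) (by linarith)).trans_eq ?_
  ring

/-- For suitable numbers of iterations, AccBiO on the regularized problem reaches the accuracy
`ε'` within the stated number of oracle calls. -/
theorem IsConvexStronglyConvex.exists_accBiO_complexity
    (h : IsConvexStronglyConvex f g Lx Lxy Ly Ltxy Lty ρxy ρyy μ)
    (hμ : 0 < μ) (hLty : μ ≤ Lty) (hLx : 0 ≤ Lx) (hLxy : 0 ≤ Lxy) (hLy : 0 ≤ Ly) (hL : 0 ≤ Ltxy)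
    (hρ : 0 ≤ ρyy) (hρ' : 0 ≤ ρxy) (hε : 0 < ε) (hR : 0 < R) (hε'0 : 0 < ε') (hτ : 0 < τ)
    (hc : 1 + Lx + Lxy + Ly + Ltxy + μ ≤ c) {xs : Euc p}
    (hxs : ∀ u, totalObj f g xs ≤ totalObj f g u) (hRB : Real.sqrt R ≤ ‖xs‖ + 1)
    (hε' : ε' / (ε / R) ≤ ‖xs‖ ^ 2) (hRi : R⁻¹ ≤ (1 + ‖xs‖⁻¹) ^ 2)
    (hLdef : L = regSmoothness f g Lx Lxy Ly Ltxy ρxy ρyy μ ε R ε')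
    (hinv : ε'⁻¹ ≤ 2 * ε⁻¹ + (4 * L + 8 * (ε / R)) * ε⁻¹ ^ 2)
    (hthr : 16 * (9 * c ^ 4 * smoothnessScale ρxy ρyy μ (deltaCSC f g μ ε xs)) ≤ ε / R →
      totalObj f g 0 - totalObj f g xs ≤ ε' / 2) :
    ∃ K M N : ℕ,
      (accBiO (_root_.regularize f ε R) g Lty μ L (ε / R) M N K).count.cost τ
        ≤ complexityConst c τ
          * Real.sqrt (smoothnessScale ρxy ρyy μ (deltaCSC f g μ ε xs) * R * Lty / (ε * μ))
          * logFactor f g Lty ρxy ρyy μ ε xs ^ 2 ∧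
      ∀ K' M' N' : ℕ, K ≤ K' → M ≤ M' → N ≤ N' →
        ‖(accBiO (_root_.regularize f ε R) g Lty μ L (ε / R) M' N' K').z
            - argminPt (totalObj (_root_.regularize f ε R) g)‖
          ≤ iterateRadius (_root_.regularize f ε R) g (ε / R) ε'
              (argminPt (totalObj (_root_.regularize f ε R) g)) ∧
        totalObj (_root_.regularize f ε R) g
            (accBiO (_root_.regularize f ε R) g Lty μ L (ε / R) M' N' K').z
          - totalObj (_root_.regularize f ε R) g (argminPt (totalObj (_root_.regularize f ε R) g))
          ≤ ε' := by
  obtain ⟨d1, d2, d3, d4⟩ := deltaCSC_terms_nonneg (f := f) (g := g) (ε := ε) hμ xs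
  have hΔ0 : 0 ≤ deltaCSC f g μ ε xs := by linarith
  have hLle := h.regSmoothness_le hμ hLx hLxy hLy hL hρ hρ' hε hR hc hxs hRB hε'
  rw [← hLdef] at hLle
  have hμx : 0 < ε / R := div_pos hε hR
  have hc1 : 1 ≤ c := by linarith
  rw [logFactor]
  set Δ := deltaCSC f g μ ε xs
  set A := smoothnessScale ρxy ρyy μ Δ with hA
  have hA0 : 0 ≤ A := by rw [hA, smoothnessScale]; positivity
  set X := 2 + ε + 1 / ε + 1 / ‖xs‖ + 1 / μ + Lty + ρxy + ρyy + Δ + ‖innerSol g xs‖ with hX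
  have e1 : 0 < 1 / ε := by positivity
  have e2 : 0 ≤ 1 / ‖xs‖ := by positivity
  have e3 : 0 < 1 / μ := by positivity
  have e4 := norm_nonneg (innerSol g xs)
  have hX2 : 2 ≤ X := by linarith
  have hlog2 : 0 < Real.log 2 := Real.log_pos (by norm_num)
  have hlogX : Real.log 2 ≤ Real.log X := Real.log_le_log (by norm_num) hX2
  set W := 100 * c * X with hWdef
  have hcX : X ≤ c * X := le_mul_of_one_le_left (by linarith) hc1
  have hcX' : c * 2 ≤ c * X := mul_le_mul_of_nonneg_left hX2 (by linarith)
  have hWX : X ≤ W := by linarith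
  have hW : 100 ≤ W := by linarith
  have hlogW : Real.log W = Real.log (100 * c) + Real.log X :=
    Real.log_mul (by linarith) (by linarith)
  have hlog1 : 1 ≤ Real.log W := by
    rw [Real.le_log_iff_exp_le (by linarith)]
    have := Real.exp_one_lt_d9
    linarith
  -- Since X ≥ 2, the additive log(100c) becomes a multiplicative constant.
  have hlogWX : Real.log W ≤ (1 + Real.log (100 * c) / Real.log 2) * Real.log X := by
    have h1 : 0 ≤ Real.log (100 * c) / Real.log 2 :=
      div_nonneg (Real.log_nonneg (by linarith)) hlog2.le
    have h2 := mul_le_mul_of_nonneg_left hlogX h1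
    rw [div_mul_cancel₀ _ hlog2.ne'] at h2
    rw [hlogW]
    linarith
  have hRW : R⁻¹ ≤ W ^ 2 := by
    refine hRi.trans (pow_le_pow_left₀ (by positivity) ?_ 2)
    rw [← one_div]
    linarith
  have key : ∀ K M N : ℕ, (totalObj f g 0 - totalObj f g xs ≤ ε' / 2 ∨
      400 * Real.sqrt (L / (ε / R)) * Real.log W ≤ K) →
      400 * Real.sqrt (Lty / μ) * Real.log W ≤ M → 400 * Real.sqrt (Lty / μ) * Real.log W ≤ N → _ :=
    fun K M N hK hM hN => h.accBiO_regularize_gap_le (W := W) hμ hLty hLx hLxy hLy hL hρ hρ' hε hR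
      hε'0 hc hxs hRB hε' hLdef hinv hW (by linarith) (by linarith)
      (by rw [← one_div]; linarith) hRW (by rw [← one_div]; linarith) (by linarith)
      (by linarith) (by linarith) (by linarith) (by linarith) hK hM hN
  have hCc := complexityConst_pos hc1 hτ
  have hceil : ∀ {t : ℝ} {n : ℕ}, ⌈t⌉₊ ≤ n → t ≤ n := fun h =>
    (Nat.le_ceil _).trans (by exact_mod_cast h)
  -- If ε/R dominates, zero outer iterations are free and accurate enough. Otherwise ε/R < 16 ·
  -- 9c⁴A, so L ≤ 17 · 9c⁴A.
  by_cases hcase : 16 * (9 * c ^ 4 * A) ≤ ε / R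
  · refine ⟨0, ⌈400 * Real.sqrt (Lty / μ) * Real.log W⌉₊,
      ⌈400 * Real.sqrt (Lty / μ) * Real.log W⌉₊, ?_, fun K' M' N' _ hM hN =>
        key K' M' N' (Or.inl (hthr hcase)) (hceil hM) (hceil hN)⟩
    refine (cost_accBiO_le hτ.le _ _ _ _ _ _ _ _ _).trans ?_
    simp only [Nat.cast_zero, zero_mul]
    positivity
  · refine ⟨⌈400 * Real.sqrt (L / (ε / R)) * Real.log W⌉₊,
      ⌈400 * Real.sqrt (Lty / μ) * Real.log W⌉₊, ⌈400 * Real.sqrt (Lty / μ) * Real.log W⌉₊, ?_,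
      fun K' M' N' hK hM hN => key K' M' N' (Or.inr (hceil hK)) (hceil hM) (hceil hN)⟩
    have hμxL : ε / R ≤ L :=
      hLdef ▸ div_le_regSmoothness hμ hLx hLxy hLy hL hρ hρ' f g ε R ε'
    have hLty0 : 0 ≤ Lty := hμ.le.trans hLty
    have hrx1 : 1 ≤ Real.sqrt (L / (ε / R)) := by
      rw [Real.one_le_sqrt, one_le_div hμx]; exact hμxL
    have hry1 : 1 ≤ Real.sqrt (Lty / μ) := by
      rw [Real.one_le_sqrt, one_le_div hμ]; exact hLty
    refine (cost_le_of_ceil hτ.le _ _ _ _ _ _ hrx1 hry1 hlog1).trans ?_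
    have hrr : Real.sqrt (L / (ε / R)) * Real.sqrt (Lty / μ)
        ≤ Real.sqrt (17 * (9 * c ^ 4)) * Real.sqrt (A * R * Lty / (ε * μ)) := by
      rw [← Real.sqrt_mul (div_nonneg (hμx.le.trans hμxL) hμx.le),
        ← Real.sqrt_mul (by positivity)]
      refine Real.sqrt_le_sqrt ?_
      have h1 : L ≤ 17 * (9 * c ^ 4 * A) := by linarith
      have h2 : L / (ε / R) ≤ 17 * (9 * c ^ 4 * A) / (ε / R) :=
        div_le_div_of_nonneg_right h1 hμx.le
      refine (mul_le_mul_of_nonneg_right h2 (div_nonneg hLty0 hμ.le)).trans_eq ?_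
      field_simp
    have hll := pow_le_pow_left₀ (by linarith) hlogWX 2
    have := mul_le_mul hrr hll (by positivity) (by positivity)
    have h3 := mul_le_mul_of_nonneg_left this (show 0 ≤ 403 ^ 2 * (τ + 1) by positivity)
    rw [complexityConst]
    refine le_trans (le_of_eq ?_) (h3.trans_eq ?_) <;> ring

lemma sqrt_add_add_mul_le {a b d Δ : ℝ} (ha : 0 ≤ a) (hb : 0 ≤ b) (hd : 0 ≤ d) (hΔ : 0 ≤ Δ) :
    Real.sqrt (a + (b + d) * Δ)
      ≤ Real.sqrt a + (Real.sqrt b + Real.sqrt d) * Real.sqrt Δ := by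
  refine Real.sqrt_le_iff.2 ⟨by positivity, ?_⟩
  have h1 := Real.sqrt_nonneg a
  have h2 := Real.sqrt_nonneg b
  have h3 := Real.sqrt_nonneg d
  have h4 := Real.sqrt_nonneg Δ
  have e : (Real.sqrt a + (Real.sqrt b + Real.sqrt d) * Real.sqrt Δ) ^ 2
      = Real.sqrt a ^ 2 + (Real.sqrt b ^ 2 + Real.sqrt d ^ 2) * Real.sqrt Δ ^ 2
        + 2 * (Real.sqrt a * (Real.sqrt b + Real.sqrt d) * Real.sqrt Δ)
        + 2 * (Real.sqrt b * Real.sqrt d) * Real.sqrt Δ ^ 2 := by ring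
  rw [e, Real.sq_sqrt ha, Real.sq_sqrt hb, Real.sq_sqrt hd, Real.sq_sqrt hΔ]
  have h5 : 0 ≤ Real.sqrt a * (Real.sqrt b + Real.sqrt d) * Real.sqrt Δ := by positivity
  have h6 : 0 ≤ Real.sqrt b * Real.sqrt d * Δ := by positivity
  linarith

lemma sqrt_le_add_one {a : ℝ} (ha : 0 ≤ a) : Real.sqrt a ≤ a + 1 :=
  Real.sqrt_le_iff.2 ⟨by positivity, by nlinarith⟩

/-- The complexity bound split into its three terms. -/
lemma sqrt_smoothnessScale_le (hμ : 0 < μ) (hLty : 0 ≤ Lty) (hρ : 0 ≤ ρyy) (hρ' : 0 ≤ ρxy)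
    (hε : 0 < ε) (hR : 0 ≤ R) {Δ : ℝ} (hΔ : 0 ≤ Δ) :
    Real.sqrt (smoothnessScale ρxy ρyy μ Δ * R * Lty / (ε * μ))
      ≤ Real.sqrt (R * Lty / (ε * μ ^ 3)) + (Real.sqrt (R * ρyy * Lty / (ε * μ ^ 4))
        + Real.sqrt (R * ρxy * Lty / (ε * μ ^ 3))) * Real.sqrt Δ := by
  have e : smoothnessScale ρxy ρyy μ Δ * R * Lty / (ε * μ) = R * Lty / (ε * μ ^ 3)
      + (R * ρyy * Lty / (ε * μ ^ 4) + R * ρxy * Lty / (ε * μ ^ 3)) * Δ := by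
    rw [smoothnessScale]
    field_simp
  rw [e]
  exact sqrt_add_add_mul_le (by positivity) (by positivity) (by positivity) hΔ

/-- The fixed-point equation that defines the smoothness parameter has exactly one solution. -/
lemma existsUnique_eq_add_mul_sqrt {a b d s t m : ℝ} (ha : 0 < a) (hb : 0 ≤ b) (hs : 0 ≤ s)
    (ht : 0 < t) (hm : 0 ≤ m) :
    ∃! L : ℝ, L = a + b * Real.sqrt (d + s / (4 * L + t) / m) := by
  set F : ℝ → ℝ := fun L => a + b * Real.sqrt (d + s / (4 * L + t) / m) with hF
  -- Holds for all real L, whatever the sign of the denominator, so every solution is positive and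
  -- lies where F is antitone.
  have hpos : ∀ L, 0 < F L := fun L => add_pos_of_pos_of_nonneg ha (by positivity)
  have hanti : ∀ L₁ L₂, 0 ≤ L₁ → L₁ ≤ L₂ → F L₂ ≤ F L₁ := by
    intro L₁ L₂ h1 h2
    simp only [hF]
    gcongr
  have hcont : ContinuousOn (fun L => L - F L) (Icc 0 (F 0)) := by
    refine continuousOn_id.sub (continuousOn_const.add (continuousOn_const.mul
      (ContinuousOn.sqrt (continuousOn_const.add (ContinuousOn.div_const
        (continuousOn_const.div (by fun_prop) ?_) m)))))
    intro L hL
    have := hL.1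
    positivity
  have hmem : (0 : ℝ) ∈ Icc (0 - F 0) (F 0 - F (F 0)) := by
    constructor
    · linarith [hpos 0]
    · linarith [hanti 0 (F 0) le_rfl (hpos 0).le]
  obtain ⟨L, _, hL2⟩ := intermediate_value_Icc (hpos 0).le hcont hmem
  refine ⟨L, by simp only [sub_eq_zero] at hL2; exact hL2, fun L' hL' => ?_⟩
  have hLF : L = F L := by simp only [sub_eq_zero] at hL2; exact hL2
  have hL'F : L' = F L' := hL'
  have h0 : 0 < L := hLF ▸ hpos L
  have h0' : 0 < L' := hL'F ▸ hpos L'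
  rcases le_total L L' with hle | hle
  · have := hanti L L' h0.le hle
    linarith
  · have := hanti L' L h0'.le hle
    linarith

end Complexity

/-! ### From the regularized gap to the two conclusions -/

section Conclusion

variable {p q : ℕ} {f g : Euc p → Euc q → ℝ} {Lx Lxy Ly Ltxy Lty ρxy ρyy μ ε ε' B L : ℝ}

lemma existsUnique_regSmoothness (hμ : 0 < μ) (hLx : 0 ≤ Lx) (hLxy : 0 ≤ Lxy) (hLy : 0 ≤ Ly)
    (hL : 0 ≤ Ltxy) (hρ : 0 ≤ ρyy) (hρ' : 0 ≤ ρxy) (hε : 0 < ε) (hB : 0 < B)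
    (f g : Euc p → Euc q → ℝ) :
    ∃! L : ℝ, L = regSmoothness f g Lx Lxy Ly Ltxy ρxy ρyy μ ε B
      (ε ^ 2 / (4 * L + 8 * ε / B)) := by
  simp only [regSmoothness, smoothnessParam]
  refine existsUnique_eq_add_mul_sqrt ?_ (by positivity) (by positivity) (by positivity)
    (by positivity)
  positivity

namespace IsConvexStronglyConvex

/-- The gap of the original objective, from the gap of the regularized one. -/
lemma totalObj_sub_le (h : IsConvexStronglyConvex f g Lx Lxy Ly Ltxy Lty ρxy ρyy μ)
    (hμ : 0 < μ) (hε : 0 < ε) {xs : Euc p} (hB : 0 < ‖xs‖) {z : Euc p}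
    (hz : totalObj (_root_.regularize f ε (‖xs‖ ^ 2)) g z
      - totalObj (_root_.regularize f ε (‖xs‖ ^ 2)) g
          (argminPt (totalObj (_root_.regularize f ε (‖xs‖ ^ 2)) g)) ≤ ε / 2) :
    totalObj f g z - totalObj f g xs ≤ ε := by
  have h1 := h.argminPt_regularize_le hμ hε (pow_pos hB 2) xs
  rw [totalObj_regularize f g ε _ xs] at h1
  rw [totalObj_regularize f g ε _ z] at hz
  have h2 : ε / (2 * ‖xs‖ ^ 2) * ‖xs‖ ^ 2 = ε / 2 := by field_simp
  have h3 : 0 ≤ ε / (2 * ‖xs‖ ^ 2) * ‖z‖ ^ 2 := by positivity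
  linarith

/-- The gradient norm of the original objective, from the gap of the regularized one. -/
lemma norm_gradient_totalObj_le (h : IsConvexStronglyConvex f g Lx Lxy Ly Ltxy Lty ρxy ρyy μ)
    (hμ : 0 < μ) (hLxy : 0 ≤ Lxy) (hLy : 0 ≤ Ly) (hL : 0 ≤ Ltxy)
    (hρ : 0 ≤ ρyy) (hρ' : 0 ≤ ρxy) (hε : 0 < ε) {xs : Euc p} (hB : 0 < ‖xs‖)
    (hxs : ∀ u, totalObj f g xs ≤ totalObj f g u) (hL0 : 0 < L)
    (hLdef : L = regSmoothness f g Lx Lxy Ly Ltxy ρxy ρyy μ ε ‖xs‖ ε')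
    (hε' : ε' = ε ^ 2 / (4 * L + 8 * ε / ‖xs‖)) {z : Euc p}
    (hzD : ‖z - argminPt (totalObj (_root_.regularize f ε ‖xs‖) g)‖
      ≤ iterateRadius (_root_.regularize f ε ‖xs‖) g (ε / ‖xs‖) ε'
        (argminPt (totalObj (_root_.regularize f ε ‖xs‖) g)))
    (hz : totalObj (_root_.regularize f ε ‖xs‖) g z
      - totalObj (_root_.regularize f ε ‖xs‖) g
          (argminPt (totalObj (_root_.regularize f ε ‖xs‖) g)) ≤ ε') :
    DifferentiableAt ℝ (totalObj f g) z ∧ ‖gradient (totalObj f g) z‖ ≤ 5 * ε := by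
  have hg := h.hasGradientAt_totalObj hμ z
  refine ⟨hg.differentiableAt, ?_⟩
  rw [hg.gradient]
  have h' := h.regularize hε.le hB
  have hgrad := h'.hasGradientAt_totalObj hμ
  have hmin := h.argminPt_regularize_le hμ hε hB
  have hnorm := h.norm_argminPt_regularize_le hμ hε hB hxs
  have heq := h.hyperGrad_regularize ε ‖xs‖ z
  have hsc := h.strongConvexOn_regularize (ε := ε) (R := ‖xs‖)
  set xt := argminPt (totalObj (_root_.regularize f ε ‖xs‖) g)
  set Φ := totalObj (_root_.regularize f ε ‖xs‖) g
  set v := hyperGrad (_root_.regularize f ε ‖xs‖) g z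
  have hε'0 : 0 < ε' := by rw [hε']; positivity
  have hv : ‖v‖ ≤ ε := by
    -- One exact gradient step from z decreases Φ̃ by ‖v‖²/(2L), which cannot exceed the gap ε'. The
    -- point z lies within D, so L is a smoothness constant there.
    have h1 := le_add_inner_gradient_add_sq hgrad (fun u =>
      h'.norm_hyperGrad_sub_le_smoothnessParam hμ hLxy hLy hL hρ hρ'
      (hzD.trans (by linarith [(norm_nonneg _).trans hzD])) u) (z - (1 / L) • v)
    rw [regSmoothness] at hLdef
    rw [← hLdef] at h1
    have h2 := hmin (z - (1 / L) • v)
    rw [sub_sub_cancel_left, inner_neg_right, inner_smul_right, real_inner_self_eq_norm_sq, norm_neg,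
      norm_smul, Real.norm_of_nonneg (by positivity), mul_pow] at h1
    have h3 : L / 2 * ((1 / L) ^ 2 * ‖v‖ ^ 2) = ‖v‖ ^ 2 / (2 * L) := by field_simp
    have h4 : 1 / L * ‖v‖ ^ 2 = 2 * (‖v‖ ^ 2 / (2 * L)) := by field_simp
    rw [h3, h4] at h1
    have h5 : ‖v‖ ^ 2 / (2 * L) ≤ ε' := by linarith
    rw [div_le_iff₀ (by positivity)] at h5
    have h6 : ε' * (2 * L) ≤ ε ^ 2 := by
      rw [hε', div_mul_eq_mul_div]
      refine div_le_of_le_mul₀ (by positivity) (by positivity) ?_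
      refine mul_le_mul_of_nonneg_left ?_ (by positivity)
      have : 0 ≤ 8 * ε / ‖xs‖ := by positivity
      linarith only [hL0, this]
    exact le_of_sq_le_sq (h5.trans h6) hε.le
  have hdist : ε / ‖xs‖ * ‖z - xt‖ ≤ ε := by
    have h1 := hsc.add_inner_gradient_le (hgrad xt) z
    rw [(hgrad xt).eq_zero_of_forall_le hmin, inner_zero_left] at h1
    have h2 : ε / ‖xs‖ / 2 * ‖z - xt‖ ^ 2 ≤ ε' := by linarith
    have h3 : ε' * (2 * (ε / ‖xs‖)) ≤ ε ^ 2 := by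
      rw [hε', div_mul_eq_mul_div]
      refine div_le_of_le_mul₀ (by positivity) (by positivity) ?_
      refine mul_le_mul_of_nonneg_left ?_ (by positivity)
      have : 0 ≤ ε / ‖xs‖ := by positivity
      rw [mul_div_assoc]
      linarith only [hL0, this]
    refine le_of_sq_le_sq ?_ hε.le
    have h4 := mul_le_mul_of_nonneg_right h2 (show 0 ≤ 2 * (ε / ‖xs‖) by positivity)
    refine le_trans (le_of_eq ?_) (h4.trans h3)
    ring
  have hz' : ε / ‖xs‖ * ‖z‖ ≤ 2 * ε := by
    have h1 : ‖z‖ ≤ ‖z - xt‖ + ‖xs‖ := by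
      have := norm_le_norm_sub_add z xt
      linarith
    have h2 := mul_le_mul_of_nonneg_left h1 (show 0 ≤ ε / ‖xs‖ by positivity)
    rw [mul_add, div_mul_cancel₀ _ hB.ne'] at h2
    linarith
  -- The contributions are ε from ∇Φ̃ and 2ε from the regularizer, 3ε in all.
  have e : hyperGrad f g z = v - (ε / ‖xs‖) • z := by rw [heq]; abel
  rw [e]
  refine (norm_sub_le _ _).trans ?_
  rw [norm_smul, Real.norm_of_nonneg (by positivity)]
  linarith

end IsConvexStronglyConvex

end Conclusion

theorem mainTheorem4
    (Lx Lxy Ly Ltxy μbar τ : ℝ) (hLx : 0 ≤ Lx) (hLxy : 0 ≤ Lxy) (hLy : 0 ≤ Ly)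
    (hLtxy : 0 ≤ Ltxy) (hμbar : 0 < μbar) (hτ : 0 < τ) :
    ∃ C : ℝ, 0 < C ∧
      ∀ (p q : ℕ) (f g : Euc p → Euc q → ℝ) (Lty ρxy ρyy μy B ε : ℝ) (xs : Euc p),
        0 < q → 0 ≤ Lty → 0 ≤ ρxy → 0 ≤ ρyy → 0 < μy → μy ≤ μbar → 0 < B → 0 < ε →
        IsConvexStronglyConvex f g Lx Lxy Ly Ltxy Lty ρxy ρyy μy →
        IsMinOn (totalObj f g) univ xs → ‖xs‖ = B →
        -- suboptimality gap: R = B², accuracy ε/2, μx = ε/B²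
        (∃ K M N : ℕ,
          (accBiO (regularize f ε (B ^ 2)) g Lty μy
              (regSmoothness f g Lx Lxy Ly Ltxy ρxy ρyy μy ε (B ^ 2) (ε / 2))
              (ε / B ^ 2) M N K).count.cost τ
            ≤ C * (B * (Real.sqrt (Lty / (ε * μy ^ 3))
                + (Real.sqrt (ρyy * Lty / (ε * μy ^ 4)) + Real.sqrt (ρxy * Lty / (ε * μy ^ 3)))
                  * Real.sqrt (deltaCSC f g μy ε xs)))
              * logFactor f g Lty ρxy ρyy μy ε xs ^ 2
          ∧ ∀ K' M' N' : ℕ, K ≤ K' → M ≤ M' → N ≤ N' →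
            totalObj f g
                (accBiO (regularize f ε (B ^ 2)) g Lty μy
                  (regSmoothness f g Lx Lxy Ly Ltxy ρxy ρyy μy ε (B ^ 2) (ε / 2))
                  (ε / B ^ 2) M' N' K').z
              - totalObj f g xs ≤ ε)
        ∧
        -- gradient norm: R = B, accuracy ε²/(4L + 8ε/B) with L the parameter itself, μx = ε/B
        (∃! L : ℝ, L = regSmoothness f g Lx Lxy Ly Ltxy ρxy ρyy μy ε B
            (ε ^ 2 / (4 * L + 8 * ε / B)))
        ∧
        (∀ L : ℝ, L = regSmoothness f g Lx Lxy Ly Ltxy ρxy ρyy μy ε B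
            (ε ^ 2 / (4 * L + 8 * ε / B)) →
          ∃ K M N : ℕ,
            (accBiO (regularize f ε B) g Lty μy L (ε / B) M N K).count.cost τ
              ≤ C * (Real.sqrt (B * Lty / (ε * μy ^ 3))
                  + (Real.sqrt (B * ρyy * Lty / (ε * μy ^ 4))
                      + Real.sqrt (B * ρxy * Lty / (ε * μy ^ 3)))
                    * Real.sqrt (deltaCSC f g μy ε xs))
                * logFactor f g Lty ρxy ρyy μy ε xs ^ 2
            ∧ ∀ K' M' N' : ℕ, K ≤ K' → M ≤ M' → N ≤ N' →
              DifferentiableAt ℝ (totalObj f g)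
                  (accBiO (regularize f ε B) g Lty μy L (ε / B) M' N' K').z
                ∧ ‖gradient (totalObj f g)
                  (accBiO (regularize f ε B) g Lty μy L (ε / B) M' N' K').z‖ ≤ 5 * ε) := by
  set c := 1 + Lx + Lxy + Ly + Ltxy + μbar with hcdef
  have hc1 : 1 ≤ c := by linarith
  refine ⟨complexityConst c τ, complexityConst_pos hc1 hτ, ?_⟩
  rintro p q f g Lty ρxy ρyy μ B ε xs hq hLty hρ' hρ hμ hμbar' hB hε h hmin rfl
  have hxs : ∀ u, totalObj f g xs ≤ totalObj f g u := fun u => hmin (mem_univ u)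
  have hμL := h.mu_le_Lty hq
  have hc : 1 + Lx + Lxy + Ly + Ltxy + μ ≤ c := by linarith
  obtain ⟨d1, d2, d3, d4⟩ := deltaCSC_terms_nonneg (f := f) (g := g) (ε := ε) hμ xs
  have hΔ0 : 0 ≤ deltaCSC f g μ ε xs := by linarith
  have hgap := h.initial_gap_le (ε := ε) hμ hLx hLxy hLy hLtxy hρ hρ' hc hxs
  have hA0 : 0 ≤ smoothnessScale ρxy ρyy μ (deltaCSC f g μ ε xs) := by
    rw [smoothnessScale]; positivity
  have hCc := (complexityConst_pos hc1 hτ).le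
  set C₁A := 9 * c ^ 4 * smoothnessScale ρxy ρyy μ (deltaCSC f g μ ε xs) with hC₁A
  have hC₁A0 : 0 ≤ C₁A := by positivity
  have hexi := existsUnique_regSmoothness hμ hLx hLxy hLy hLtxy hρ hρ' hε hB f g
  refine ⟨?_, hexi, fun L hLdef => ?_⟩
  · have hR : 0 < ‖xs‖ ^ 2 := by positivity
    obtain ⟨K, M, N, hcost, hall⟩ := h.exists_accBiO_complexity (ε' := ε / 2) (R := ‖xs‖ ^ 2)
      (c := c) hμ hμL hLx hLxy hLy hLtxy hρ hρ' hε hR (by positivity) hτ hc hxs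
      (by rw [Real.sqrt_sq hB.le]; linarith)
      (by
        have e : ε / 2 / (ε / ‖xs‖ ^ 2) = ‖xs‖ ^ 2 / 2 := by field_simp
        rw [e]; linarith)
      (by
        rw [← inv_pow]
        exact pow_le_pow_left₀ (by positivity) (by linarith) 2)
      rfl
      (by
        have h1 : ε / ‖xs‖ ^ 2 ≤ regSmoothness f g Lx Lxy Ly Ltxy ρxy ρyy μ ε (‖xs‖ ^ 2) (ε / 2) :=
          div_le_regSmoothness hμ hLx hLxy hLy hLtxy hρ hρ' f g _ _ _
        have h2 : 0 < ε / ‖xs‖ ^ 2 := by positivity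
        have h3 : 0 ≤ (4 * regSmoothness f g Lx Lxy Ly Ltxy ρxy ρyy μ ε (‖xs‖ ^ 2) (ε / 2)
          + 8 * (ε / ‖xs‖ ^ 2)) * ε⁻¹ ^ 2 := mul_nonneg (by linarith) (by positivity)
        rw [inv_div, div_eq_mul_inv]
        exact le_add_of_nonneg_right h3)
      -- In this case the initial gap is at most C₁A B²/2 ≤ ε/32, below ε'/2 = ε/4.
      (fun h1 => by
        rw [le_div_iff₀ hR] at h1
        have h2 : 0 ≤ C₁A * ‖xs‖ ^ 2 := by positivity
        linarith only [h1, h2, hgap])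
    refine ⟨K, M, N, hcost.trans ?_, fun K' M' N' hK hM hN =>
      h.totalObj_sub_le hμ hε hB (hall K' M' N' hK hM hN).2⟩
    refine mul_le_mul_of_nonneg_right (mul_le_mul_of_nonneg_left ?_ hCc) (sq_nonneg _)
    refine (sqrt_smoothnessScale_le hμ hLty hρ hρ' hε hR.le hΔ0).trans_eq ?_
    have hs : ∀ a : ℝ, Real.sqrt (‖xs‖ ^ 2 * a) = ‖xs‖ * Real.sqrt a := fun a => by
      rw [Real.sqrt_mul hR.le, Real.sqrt_sq hB.le]
    simp only [mul_assoc, mul_div_assoc, hs]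
    ring
  · set ε' := ε ^ 2 / (4 * L + 8 * ε / ‖xs‖) with hε'def
    have hμx : 0 < ε / ‖xs‖ := by positivity
    have hLμ : ε / ‖xs‖ ≤ L :=
      hLdef ▸ div_le_regSmoothness hμ hLx hLxy hLy hLtxy hρ hρ' f g ε ‖xs‖ _
    have hL0 : 0 < L := hμx.trans_le hLμ
    have hden : 4 * L + 8 * ε / ‖xs‖ = 4 * L + 8 * (ε / ‖xs‖) := by rw [mul_div_assoc]
    have hε'0 : 0 < ε' := by positivity
    have hRB : Real.sqrt ‖xs‖ ≤ ‖xs‖ + 1 := sqrt_le_add_one (norm_nonneg xs)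
    have hε'B : ε' / (ε / ‖xs‖) ≤ ‖xs‖ ^ 2 := by
      rw [div_le_iff₀ hμx, hε'def, hden]
      refine div_le_of_le_mul₀ (by positivity) (by positivity) ?_
      have e : ‖xs‖ ^ 2 * (ε / ‖xs‖) * (4 * L + 8 * (ε / ‖xs‖))
        = 4 * (‖xs‖ * ε * L) + 8 * ε ^ 2 := by field_simp
      rw [e]
      have : 0 ≤ ‖xs‖ * ε * L := by positivity
      have h8 : 0 ≤ ε ^ 2 := sq_nonneg ε
      linarith only [this, h8]
    have hLle := h.regSmoothness_le hμ hLx hLxy hLy hLtxy hρ hρ' hε hB hc hxs hRB hε'B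
    rw [← hLdef, ← hC₁A] at hLle
    obtain ⟨K, M, N, hcost, hall⟩ := h.exists_accBiO_complexity (ε' := ε') (R := ‖xs‖)
      (c := c) hμ hμL hLx hLxy hLy hLtxy hρ hρ' hε hB hε'0 hτ hc hxs hRB hε'B
      (by
        have h1 : 0 ≤ ‖xs‖⁻¹ := by positivity
        have h2 := sq_nonneg ‖xs‖⁻¹
        linarith only [h1, h2])
      hLdef
      (by
        have h1 : 0 < ε⁻¹ := by positivity
        rw [hε'def, inv_div, div_eq_mul_inv, hden, inv_pow]
        exact le_add_of_nonneg_left (by positivity))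
      -- Here L ≤ (17/16) ε/B, so ε' ≥ εB/16, while the initial gap is at most C₁A B²/2 ≤ εB/32.
      -- This is where the threshold 16 comes from.
      (fun h1 => by
        have h2 : ε * ‖xs‖ / 16 ≤ ε' := by
          rw [hε'def, hden, le_div_iff₀ (by positivity)]
          have h3 : 4 * L + 8 * (ε / ‖xs‖) ≤ 16 * (ε / ‖xs‖) := by
            linarith only [h1, hLle, hC₁A0]
          refine (mul_le_mul_of_nonneg_left h3 (by positivity)).trans_eq ?_
          field_simp
        rw [le_div_iff₀ hB] at h1
        have h4 := mul_le_mul_of_nonneg_right h1 hB.le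
        have h5 : C₁A * ‖xs‖ * ‖xs‖ = C₁A * ‖xs‖ ^ 2 := by ring
        linarith only [h2, h4, h5, hgap])
    refine ⟨K, M, N, hcost.trans ?_, fun K' M' N' hK hM hN => ?_⟩
    · refine mul_le_mul_of_nonneg_right (mul_le_mul_of_nonneg_left ?_ hCc) (sq_nonneg _)
      exact sqrt_smoothnessScale_le hμ hLty hρ hρ' hε hB.le hΔ0
    · obtain ⟨h1, h2⟩ := hall K' M' N' hK hM hN
      exact h.norm_gradient_totalObj_le hμ hLxy hLy hLtxy hρ hρ' hε hB hxs hL0 hLdef hε'def h1 h2
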